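/- Let $c\in\{-1,0,1\}$, let $\mathbb{Q}^n(c)$ be the standard $n$-dimensional space form of curvature $c$ (the unit sphere $\mathbb{S}^n$ for $c=1$, Euclidean space $\mathbb{R}^n$ for $c=0$, hyperbolic space $\mathbb{H}^n$ for $c=-1$) with metric $g_{\mathbb{Q}}$, let $I\subset\mathbb{R}$ be an open interval and $f:I\to(0,\infty)$ a smooth function. Let $I\times_f\mathbb{Q}^n(c)$ be the product $I\times\mathbb{Q}^n(c)$ with the warped metric $\langle\,,\rangle=dt^2+f(t)^2g_{\mathbb{Q}}$. Let $M^n$ be an (immersed) hypersurface of $I\times_f\mathbb{Q}^n(c)$ with smooth unit normal field $\mathcal{N}$, induced metric $\langle\,,\rangle$, Levi-Civita connection $\nabla$ and shape operator $A$ given by $AX=-\overline{\nabla}_X\mathcal{N}$, where $\overline\nabla$ is the Levi-Civita connection of $I\times_f\mathbb{Q}^n(c)$. Let $\pi:M\to I$ be the height function (the projection to $I$), and write $\partial_t=T+\theta\mathcal{N}$ along $M$, with $T$ tangent to $M$ and $\theta=\langle\partial_t,\mathcal{N}\rangle$; below, $f$ and $f'$ are evaluated at $\pi$. Let $U\subset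 M$ be an open set on which $T$ does not vanish, and let $\lambda_n:M\to\mathbb{R}$ be a function (of no assumed regularity) with $AT=\lambda_nT$ on $U$. Then, on $U$: 1. the integral curves of $\frac{T}{|T|}$ are geodesics of $M$; 2. $\lambda_n$ is smooth and $$\nabla\lambda_n=\left(\nabla_{\frac{T}{|T|}}A\right)\left(\frac{T}{|T|}\right)=\left\langle\frac{T}{|T|},\nabla\lambda_n\right\rangle\frac{T}{|T|};$$ 3. $\nabla\theta=-\left(\lambda_n+\frac{f'}{f}\theta\right)T$. In particular, for every $t$, the functions $|T|^2$, $\theta$ and $\lambda_n$ are constant on each connected subset of $\{x\in U:\pi(x)=t\}$; hence they are constant on each connected component of the regular levels of $\pi$ contained in $U$. -/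

import Mathlib

open Set Manifold
open scoped ContDiff

noncomputable section

/-! ## Riemannian geometry of a metric on a smooth `n`-manifold -/

/-- The vector that represents the linear form `α` with respect to the inner product `B`,
i.e. the vector `u` with `B u w = α w` for all `w`. -/
def representer {W : Type*} [Zero W] (B : W → W → ℝ) (α : W → ℝ) : W :=
  haveI : Nonempty W := ⟨0⟩
  Classical.epsilon fun u => ∀ w, B u w = α w

/-- For an inner product on a finite-dimensional space, `representer` does represent the form,
and it is the only vector that does. -/
theorem representer_spec {W : Type*} [AddCommGroup W] [Module ℝ W] [FiniteDimensional ℝ W]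
    (B : W →ₗ[ℝ] W →ₗ[ℝ] ℝ) (hB : ∀ w, w ≠ 0 → 0 < B w w) (α : W →ₗ[ℝ] ℝ) :
    (∀ w, B (representer (fun u w => B u w) (fun w => α w)) w = α w) ∧
      ∀ u, (∀ w, B u w = α w) → u = representer (fun u w => B u w) (fun w => α w) := by
  have hinj : Function.Injective B := by
    rw [← LinearMap.ker_eq_bot, LinearMap.ker_eq_bot']
    intro w hw
    by_contra hne
    have h1 := hB w hne
    rw [hw] at h1
    simp at h1
  have hsurj : Function.Surjective B :=
    (LinearMap.injective_iff_surjective_of_finrank_eq_finrank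
      (Subspace.dual_finrank_eq (K := ℝ) (V := W)).symm).1 hinj
  have hex : ∃ u, ∀ w, B u w = α w := by
    obtain ⟨u, hu⟩ := hsurj α
    exact ⟨u, fun w => by rw [hu]⟩
  have hspec := Classical.epsilon_spec hex
  refine ⟨hspec, fun u hu => hinj (LinearMap.ext fun w => ?_)⟩
  rw [hu w]
  exact (hspec w).symm

section Riemannian

variable {n : ℕ} {M : Type*} [TopologicalSpace M] [ChartedSpace (EuclideanSpace ℝ (Fin n)) M]

/-- The coefficients of the metric `g` in the chart around `p`, as a function of the chart
coordinates `y`. -/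
def chartMetric
    (g : ∀ x : M, TangentSpace (𝓡 n) x → TangentSpace (𝓡 n) x → ℝ) (p : M)
    (y v w : EuclideanSpace ℝ (Fin n)) : ℝ :=
  g ((extChartAt (𝓡 n) p).symm y)
    (mfderiv (𝓡 n) (𝓡 n) (extChartAt (𝓡 n) p).symm y v)
    (mfderiv (𝓡 n) (𝓡 n) (extChartAt (𝓡 n) p).symm y w)

/-- The Christoffel symbols `Γ(v, w)` at the point `p` of the Levi-Civita connection of `g`, in the
chart around `p`:
`g(Γ(v, w), z) = 1/2 (∂_v g(w, z) + ∂_w g(v, z) - ∂_z g(v, w))` for all `z`. -/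
def christoffel
    (g : ∀ x : M, TangentSpace (𝓡 n) x → TangentSpace (𝓡 n) x → ℝ) (p : M)
    (v w : EuclideanSpace ℝ (Fin n)) : EuclideanSpace ℝ (Fin n) :=
  representer (chartMetric g p (extChartAt (𝓡 n) p p)) fun z =>
    (1 / 2 : ℝ) *
      (fderiv ℝ (fun y => chartMetric g p y w z) (extChartAt (𝓡 n) p p) v
        + fderiv ℝ (fun y => chartMetric g p y v z) (extChartAt (𝓡 n) p p) w
        - fderiv ℝ (fun y => chartMetric g p y v w) (extChartAt (𝓡 n) p p) z)

/-- The vector field `Y` in the chart around `p`, as a function of the chart coordinates `y`. -/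
def chartField (Y : ∀ x : M, TangentSpace (𝓡 n) x) (p : M) (y : EuclideanSpace ℝ (Fin n)) :
    EuclideanSpace ℝ (Fin n) :=
  mfderiv (𝓡 n) (𝓡 n) (extChartAt (𝓡 n) p) ((extChartAt (𝓡 n) p).symm y)
    (Y ((extChartAt (𝓡 n) p).symm y))

/-- The Levi-Civita covariant derivative `(∇_v Y)(p)` of the vector field `Y` in the direction
`v ∈ T_p M`; in the chart around `p` it is `∂_v Y + Γ(v, Y)`. -/
def covDeriv
    (g : ∀ x : M, TangentSpace (𝓡 n) x → TangentSpace (𝓡 n) x → ℝ)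
    (Y : ∀ x : M, TangentSpace (𝓡 n) x) (p : M) (v : TangentSpace (𝓡 n) p) :
    TangentSpace (𝓡 n) p :=
  let y₀ : EuclideanSpace ℝ (Fin n) := extChartAt (𝓡 n) p p
  let v' : EuclideanSpace ℝ (Fin n) := mfderiv (𝓡 n) (𝓡 n) (extChartAt (𝓡 n) p) p v
  let d : EuclideanSpace ℝ (Fin n) :=
    fderiv ℝ (chartField Y p) y₀ v' + christoffel g p v' (chartField Y p y₀)
  (mfderiv (𝓡 n) (𝓡 n) (extChartAt (𝓡 n) p) p).inverse d

/-- The covariant derivative `(∇_v A) Y = ∇_v (A Y) - A (∇_v Y)` at `p` of a `(1,1)`-tensor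
field `A`. -/
def covDerivTensor
    (g : ∀ x : M, TangentSpace (𝓡 n) x → TangentSpace (𝓡 n) x → ℝ)
    (A : ∀ x : M, TangentSpace (𝓡 n) x → TangentSpace (𝓡 n) x)
    (Y : ∀ x : M, TangentSpace (𝓡 n) x) (p : M) (v : TangentSpace (𝓡 n) p) :
    TangentSpace (𝓡 n) p :=
  covDeriv g (fun x => A x (Y x)) p v - A p (covDeriv g Y p v)

/-- The gradient `∇h` of a function: `g(∇h, w) = dh(w)` for all `w`. -/
def riemGradient
    (g : ∀ x : M, TangentSpace (𝓡 n) x → TangentSpace (𝓡 n) x → ℝ) (h : M → ℝ) (x : M) :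
    TangentSpace (𝓡 n) x :=
  representer (g x) fun w => (mfderiv (𝓡 n) 𝓘(ℝ, ℝ) h x w : ℝ)

/-- `γ` is a geodesic on the open set `J ⊆ ℝ`: it is smooth there and `∇_{γ'} γ' = 0`, that is,
`γ'' + Γ(γ', γ') = 0` in the chart around each of its points. -/
def IsGeodesicOn
    (g : ∀ x : M, TangentSpace (𝓡 n) x → TangentSpace (𝓡 n) x → ℝ) (γ : ℝ → M) (J : Set ℝ) :
    Prop :=
  ContMDiffOn 𝓘(ℝ, ℝ) (𝓡 n) ∞ γ J ∧
    ∀ s ∈ J,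
      deriv (deriv fun r => extChartAt (𝓡 n) (γ s) (γ r)) s
        + christoffel g (γ s)
            (deriv (fun r => extChartAt (𝓡 n) (γ s) (γ r)) s)
            (deriv (fun r => extChartAt (𝓡 n) (γ s) (γ r)) s) = 0

end Riemannian

/-! ## The space forms and the warped products -/

/-- The symmetric bilinear form `c v₀ w₀ + v₁ w₁ + ⋯ + vₙ wₙ` on `ℝⁿ⁺¹`. -/
def quadricForm {n : ℕ} (c : ℝ) (v w : EuclideanSpace ℝ (Fin (n + 1))) : ℝ :=
  c * (v 0 * w 0) + ∑ i : Fin n, v i.succ * w i.succ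

/-- The standard model of the space form `Qⁿ(c)`, `c ∈ {-1, 0, 1}`, as a hypersurface of `ℝⁿ⁺¹` on
whose tangent spaces `quadricForm c` is the Riemannian metric:
* `c = 1`: the unit sphere of Euclidean space;
* `c = 0`: the affine hyperplane `x₀ = 1` with the Euclidean metric;
* `c = -1`: the sheet `x₀ > 0` of the hyperboloid `-x₀² + x₁² + ⋯ + xₙ² = -1` of Minkowski
  space. -/
def spaceForm (n : ℕ) (c : ℝ) : Set (EuclideanSpace ℝ (Fin (n + 1))) :=
  {q | q 0 ^ 2 + c * ∑ i : Fin n, q i.succ ^ 2 = 1 ∧ (c ≤ 0 → 0 < q 0)}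

/-- `v` is tangent to `Qⁿ(c)` at `q`. -/
def IsTangentSpaceForm {n : ℕ} (c : ℝ) (q v : EuclideanSpace ℝ (Fin (n + 1))) : Prop :=
  q 0 * v 0 + c * ∑ i : Fin n, q i.succ * v i.succ = 0

/-- The space `ℝ × ℝⁿ⁺¹` that contains `I × Qⁿ(c)`. -/
abbrev Amb (n : ℕ) : Type := ℝ × EuclideanSpace ℝ (Fin (n + 1))

/-- The underlying set of the warped product `I ×_f Qⁿ(c)`. -/
def warpedProduct (n : ℕ) (I : Set ℝ) (c : ℝ) : Set (Amb n) :=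
  {p | p.1 ∈ I ∧ p.2 ∈ spaceForm n c}

/-- The metric `dt² + f(t)² g_{Q(c)}` at the point `p`. -/
def warpedMetric {n : ℕ} (f : ℝ → ℝ) (c : ℝ) (p v w : Amb n) : ℝ :=
  v.1 * w.1 + f p.1 ^ 2 * quadricForm c v.2 w.2

/-- The Levi-Civita connection of `I ×_f Qⁿ(c)`: for tangent fields
`∇_V W = D_V W + warpedGamma f c p V W`, where `D` is the flat derivative of `ℝ × ℝⁿ⁺¹`. The lemmas
`warpedGamma_symm`, `warpedGamma_tangent` and `warpedGamma_metric` show that this is a torsion-free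
metric connection of the warped product. -/
def warpedGamma {n : ℕ} (f : ℝ → ℝ) (c : ℝ) (p v w : Amb n) : Amb n :=
  (-(f p.1 * deriv f p.1 * quadricForm c v.2 w.2),
    (deriv f p.1 / f p.1) • (v.1 • w.2 + w.1 • v.2) + (c * quadricForm c v.2 w.2) • p.2)

/-- Symmetry, so that `∇_V W - ∇_W V = [V, W]`. -/
theorem warpedGamma_symm {n : ℕ} (f : ℝ → ℝ) (c : ℝ) (p v w : Amb n) :
    warpedGamma f c p v w = warpedGamma f c p w v := by
  have h : quadricForm c v.2 w.2 = quadricForm c w.2 v.2 := by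
    simp only [quadricForm, mul_comm]
  simp only [warpedGamma, h, add_comm]

theorem hasDerivAt_coord {n : ℕ} {W : ℝ → Amb n} {W' : Amb n} {s : ℝ} (h : HasDerivAt W W' s)
    (i : Fin (n + 1)) : HasDerivAt (fun r => (W r).2 i) (W'.2 i) s := by
  have h2 : HasDerivAt (fun r => (W r).2) W'.2 s := h.snd
  exact ((EuclideanSpace.proj (𝕜 := ℝ) i).hasFDerivAt.comp_hasDerivAt s h2)

/-- The covariant derivative of a tangent field `W` along a curve `p` of the warped product is
tangent to the warped product. -/
theorem warpedGamma_tangent {n : ℕ} (f : ℝ → ℝ) {c : ℝ} (hc : c = -1 ∨ c = 0 ∨ c = 1) (I : Set ℝ)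
    (p W : ℝ → Amb n) (p' W' : Amb n) (s : ℝ) (hp : HasDerivAt p p' s) (hW : HasDerivAt W W' s)
    (hmem : ∀ r, p r ∈ warpedProduct n I c) (hpt : IsTangentSpaceForm c (p s).2 p'.2)
    (hWt : ∀ r, IsTangentSpaceForm c (p r).2 (W r).2) :
    IsTangentSpaceForm c (p s).2 (W' + warpedGamma f c (p s) p' (W s)).2 := by
  have hd : HasDerivAt (fun r => (p r).2 0 * (W r).2 0
      + c * ∑ i : Fin n, (p r).2 i.succ * (W r).2 i.succ) _ s :=
    ((hasDerivAt_coord hp 0).mul (hasDerivAt_coord hW 0)).add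
      ((HasDerivAt.fun_sum fun (i : Fin n) _ =>
        (hasDerivAt_coord hp i.succ).mul (hasDerivAt_coord hW i.succ)).const_mul c)
  have h0 : (fun r => (p r).2 0 * (W r).2 0
      + c * ∑ i : Fin n, (p r).2 i.succ * (W r).2 i.succ) = fun _ => 0 := funext hWt
  rw [h0] at hd
  have e := hd.unique (hasDerivAt_const s (0 : ℝ))
  have hq := (hmem s).2.1
  have hw := hWt s
  simp only [IsTangentSpaceForm] at *
  simp only [Prod.snd_add, warpedGamma, PiLp.add_apply, PiLp.smul_apply, smul_eq_mul, mul_add,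
    Finset.sum_add_distrib] at *
  have s1 : ∀ (k : ℝ) (a b : Fin n → ℝ), ∑ i, a i * (k * b i) = k * ∑ i, a i * b i := by
    intro k a b
    rw [Finset.mul_sum]
    exact Finset.sum_congr rfl fun i _ => by ring
  simp only [s1, quadricForm] at *
  have sq : ∑ i : Fin n, (p s).2 i.succ * (p s).2 i.succ = ∑ i : Fin n, (p s).2 i.succ ^ 2 :=
    Finset.sum_congr rfl fun i _ => by ring
  rw [sq]
  rcases hc with rfl | rfl | rfl
  · linear_combination e + (deriv f (p s).1 / f (p s).1) * ((p'.1) * hw + (W s).1 * hpt)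
      + (p'.2 0 * (W s).2 0 - ∑ i : Fin n, p'.2 i.succ * (W s).2 i.succ) * hq
  · have hp0 : (p s).2 0 ≠ 0 := by
      intro h
      rw [h] at hq
      norm_num at hq
    have a1 : p'.2 0 = 0 := by simpa [hp0] using hpt
    have a2 : (W s).2 0 = 0 := by simpa [hp0] using hw
    rw [a1, a2] at e ⊢
    linear_combination e
  · linear_combination e + (deriv f (p s).1 / f (p s).1) * ((p'.1) * hw + (W s).1 * hpt)
      + (p'.2 0 * (W s).2 0 + ∑ i : Fin n, p'.2 i.succ * (W s).2 i.succ) * hq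

/-- Compatibility with the metric: along a curve `p`,
`d/ds ⟨W, Z⟩ = ⟨∇_{p'} W, Z⟩ + ⟨W, ∇_{p'} Z⟩` for tangent fields `W`, `Z`. -/
theorem warpedGamma_metric {n : ℕ} (f : ℝ → ℝ) {c : ℝ} (hc : c = -1 ∨ c = 0 ∨ c = 1)
    (p W Z : ℝ → Amb n) (p' W' Z' : Amb n) (s : ℝ) (hp : HasDerivAt p p' s)
    (hW : HasDerivAt W W' s) (hZ : HasDerivAt Z Z' s)
    (hf : DifferentiableAt ℝ f (p s).1) (hf0 : f (p s).1 ≠ 0)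
    (hWt : IsTangentSpaceForm c (p s).2 (W s).2) (hZt : IsTangentSpaceForm c (p s).2 (Z s).2) :
    HasDerivAt (fun r => warpedMetric f c (p r) (W r) (Z r))
      (warpedMetric f c (p s) (W' + warpedGamma f c (p s) p' (W s)) (Z s)
        + warpedMetric f c (p s) (W s) (Z' + warpedGamma f c (p s) p' (Z s))) s := by
  have hfd : HasDerivAt (fun r => f (p r).1) (deriv f (p s).1 * p'.1) s :=
    hf.hasDerivAt.comp s hp.fst
  have hW1 : HasDerivAt (fun r => (W r).1) W'.1 s := hW.fst
  have hZ1 : HasDerivAt (fun r => (Z r).1) Z'.1 s := hZ.fst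
  have hd : HasDerivAt (fun r => warpedMetric f c (p r) (W r) (Z r)) _ s :=
    (hW1.mul hZ1).add ((hfd.pow 2).mul
      ((((hasDerivAt_coord hW 0).mul (hasDerivAt_coord hZ 0)).const_mul c).add
        (HasDerivAt.fun_sum fun (i : Fin n) _ =>
          (hasDerivAt_coord hW i.succ).mul (hasDerivAt_coord hZ i.succ))))
  convert hd using 1
  have s1 : ∀ (k : ℝ) (a b : Fin n → ℝ), ∑ i, a i * (k * b i) = k * ∑ i, a i * b i := by
    intro k a b
    rw [Finset.mul_sum]
    exact Finset.sum_congr rfl fun i _ => by ring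
  have s2 : ∀ (k : ℝ) (a b : Fin n → ℝ), ∑ i, k * a i * b i = k * ∑ i, a i * b i := by
    intro k a b
    rw [Finset.mul_sum]
    exact Finset.sum_congr rfl fun i _ => by ring
  have c1 : ∑ i : Fin n, (W s).2 i.succ * (p s).2 i.succ
      = ∑ i : Fin n, (p s).2 i.succ * (W s).2 i.succ :=
    Finset.sum_congr rfl fun i _ => by ring
  have c2 : ∑ i : Fin n, (W s).2 i.succ * p'.2 i.succ
      = ∑ i : Fin n, p'.2 i.succ * (W s).2 i.succ :=
    Finset.sum_congr rfl fun i _ => by ring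
  simp only [IsTangentSpaceForm] at hWt hZt
  simp only [warpedMetric, warpedGamma, quadricForm, Prod.snd_add, Prod.fst_add, PiLp.add_apply,
    PiLp.smul_apply, smul_eq_mul, mul_add, add_mul, Finset.sum_add_distrib, s1, s2, c1, c2]
  have hpow : ((fun r => f (p r).1) ^ 2) s = f (p s).1 ^ 2 := rfl
  rw [hpow]
  rcases hc with rfl | rfl | rfl
  · field_simp
    linear_combination
      f (p s).1 ^ 2 * (-(p'.2 0 * (W s).2 0) + ∑ i : Fin n, p'.2 i.succ * (W s).2 i.succ) * hZt
      + f (p s).1 ^ 2 * (-(p'.2 0 * (Z s).2 0) + ∑ i : Fin n, p'.2 i.succ * (Z s).2 i.succ) * hWt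
  · field_simp
    ring
  · field_simp
    linear_combination
      f (p s).1 ^ 2 * (p'.2 0 * (W s).2 0 + ∑ i : Fin n, p'.2 i.succ * (W s).2 i.succ) * hZt
      + f (p s).1 ^ 2 * (p'.2 0 * (Z s).2 0 + ∑ i : Fin n, p'.2 i.succ * (Z s).2 i.succ) * hWt

/-! ## Hypersurfaces of the warped product -/

section Hypersurface

variable {n : ℕ} {M : Type*} [TopologicalSpace M] [ChartedSpace (EuclideanSpace ℝ (Fin n)) M]

/-- The differential `dχ_x`. -/
def diffAmb (χ : M → Amb n) (x : M) (v : TangentSpace (𝓡 n) x) : Amb n :=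
  mfderiv (𝓡 n) 𝓘(ℝ, Amb n) χ x v

/-- `χ : M → I ×_f Qⁿ(c)` is a smooth immersion of the `n`-manifold `M`, that is, an immersed
hypersurface, and `N` is a smooth unit normal field along `χ`. -/
structure IsHypersurface (I : Set ℝ) (f : ℝ → ℝ) (c : ℝ) (χ N : M → Amb n) : Prop where
  smooth : ContMDiff (𝓡 n) 𝓘(ℝ, Amb n) ∞ χ
  mem : ∀ x, χ x ∈ warpedProduct n I c
  immersion : ∀ x, Function.Injective (diffAmb χ x)
  normal_smooth : ContMDiff (𝓡 n) 𝓘(ℝ, Amb n) ∞ N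
  normal_tangent : ∀ x, IsTangentSpaceForm c (χ x).2 (N x).2
  normal_unit : ∀ x, warpedMetric f c (χ x) (N x) (N x) = 1
  normal_orthogonal : ∀ x v, warpedMetric f c (χ x) (N x) (diffAmb χ x v) = 0

/-- The metric that `χ` induces on `M`. -/
def inducedMetric (f : ℝ → ℝ) (c : ℝ) (χ : M → Amb n) (x : M) (v w : TangentSpace (𝓡 n) x) : ℝ :=
  warpedMetric f c (χ x) (diffAmb χ x v) (diffAmb χ x w)

/-- The tangential part of the ambient vector `z` at `χ x`, as a vector of `T_x M`. -/
def tangentialPart (f : ℝ → ℝ) (c : ℝ) (χ : M → Amb n) (x : M) (z : Amb n) :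
    TangentSpace (𝓡 n) x :=
  representer (inducedMetric f c χ x) fun w => warpedMetric f c (χ x) z (diffAmb χ x w)

/-- The covariant derivative of the field `N` along `χ`, in the direction `v`, with respect to the
Levi-Civita connection of `I ×_f Qⁿ(c)`. -/
def ambCovDeriv (f : ℝ → ℝ) (c : ℝ) (χ N : M → Amb n) (x : M) (v : TangentSpace (𝓡 n) x) :
    Amb n :=
  diffAmb N x v + warpedGamma f c (χ x) (diffAmb χ x v) (N x)

/-- The shape operator `A v = -(∇_v N)` of `M` associated with `N`. -/
def shapeOperator (f : ℝ → ℝ) (c : ℝ) (χ N : M → Amb n) (x : M) (v : TangentSpace (𝓡 n) x) :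
    TangentSpace (𝓡 n) x :=
  tangentialPart f c χ x (-ambCovDeriv f c χ N x v)

/-- The height function, the projection of `M` to `I`. -/
def heightFun (χ : M → Amb n) (x : M) : ℝ := (χ x).1

/-- The tangential part `T` of `∂_t`. -/
def fieldT (f : ℝ → ℝ) (c : ℝ) (χ : M → Amb n) (x : M) : TangentSpace (𝓡 n) x :=
  tangentialPart f c χ x (1, 0)

/-- The function `|T|²`. -/
def normSqT (f : ℝ → ℝ) (c : ℝ) (χ : M → Amb n) (x : M) : ℝ :=
  inducedMetric f c χ x (fieldT f c χ x) (fieldT f c χ x)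

/-- The field `T / |T|`. -/
def unitT (f : ℝ → ℝ) (c : ℝ) (χ : M → Amb n) (x : M) : TangentSpace (𝓡 n) x :=
  (Real.sqrt (normSqT f c χ x))⁻¹ • fieldT f c χ x

/-- The angle function `θ = ⟨∂_t, N⟩`. -/
def angleFun (f : ℝ → ℝ) (c : ℝ) (χ N : M → Amb n) (x : M) : ℝ :=
  warpedMetric f c (χ x) (1, 0) (N x)

end Hypersurface

end

noncomputable section

open scoped Topology

/-! ## Linear algebra of the warped metric -/

/-! Write `E = T/|T|` and `k = f'/f`. Everything follows from one formula for `dθ`; the Codazzi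
equation is not needed. The tangential part of `∂_t` represents `dπ`, so `T` is the gradient of the
height, and `∂_t = T + θN` gives `|T|² = 1 - θ²` (`diffAmb_fieldT`, `normSqT_eq`). In the warped
product `∇_v ∂_t = k (v - ⟨∂_t, v⟩ ∂_t)`. Differentiating `θ = ⟨∂_t, N⟩` and using the symmetry of
`A` gives `dθ = -⟨AT, ·⟩ - kθ dπ` (`mfderiv_angle`).

If `AT = λT` on `U`, this reads `dθ = -(λ + kθ) dπ`, which is the formula for `∇θ`. Evaluating it on
a vector on which `dπ` does not vanish expresses `λ` through smooth functions. Applying `d` gives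
`d(λ + kθ) ∧ dπ = 0`; since `dk` and `dθ` are multiples of `dπ`, also `dλ ∧ dπ = 0`
(`fderiv_eigenvalue_wedge`), so `∇λ` is a multiple of `T`.

For the geodesics, `E = (1 - θ²)^(-1/2) (∂_t - θN)` is differentiated in the ambient space. By the
Gauss formula (`inducedBilin_covDeriv`) the tangential part of the result is `∇_E E`, and it
vanishes (`covDeriv_unitT`). Then `(∇_E A)E = ∇_E(λE) - A(∇_E E) = dλ(E) E`, which is `∇λ`.

Finally, `π` is a submersion on `U`, and a function whose differential is a multiple of `dπ` is
locally a function of `π` (`exists_nhds_eq_of_fderiv_proportional`), hence constant on connected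
subsets of its levels.

The intrinsic objects are defined through Christoffel symbols in charts, so the computations are
made for the parametrization `inChart p χ` between vector spaces and then transferred to `M`. -/

theorem quadricForm_add_left {n : ℕ} (c : ℝ) (u v w : EuclideanSpace ℝ (Fin (n + 1))) :
    quadricForm c (u + v) w = quadricForm c u w + quadricForm c v w := by
  simp only [quadricForm, PiLp.add_apply, add_mul, Finset.sum_add_distrib]
  ring

theorem quadricForm_smul_left {n : ℕ} (c a : ℝ) (v w : EuclideanSpace ℝ (Fin (n + 1))) :
    quadricForm c (a • v) w = a * quadricForm c v w := by
  simp only [quadricForm, PiLp.smul_apply, smul_eq_mul, mul_add, Finset.mul_sum]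
  congr 1
  · ring
  · exact Finset.sum_congr rfl fun i _ => by ring

theorem quadricForm_comm {n : ℕ} (c : ℝ) (v w : EuclideanSpace ℝ (Fin (n + 1))) :
    quadricForm c v w = quadricForm c w v := by
  simp only [quadricForm, mul_comm]

theorem quadricForm_zero_left {n : ℕ} (c : ℝ) (w : EuclideanSpace ℝ (Fin (n + 1))) :
    quadricForm c 0 w = 0 := by
  simp [quadricForm]

theorem warpedMetric_comm {n : ℕ} (f : ℝ → ℝ) (c : ℝ) (p v w : Amb n) :
    warpedMetric f c p v w = warpedMetric f c p w v := by
  simp only [warpedMetric, quadricForm_comm c v.2, mul_comm v.1]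

theorem warpedMetric_add_left {n : ℕ} (f : ℝ → ℝ) (c : ℝ) (p u v w : Amb n) :
    warpedMetric f c p (u + v) w = warpedMetric f c p u w + warpedMetric f c p v w := by
  simp only [warpedMetric, Prod.fst_add, Prod.snd_add, quadricForm_add_left]
  ring

theorem warpedMetric_smul_left {n : ℕ} (f : ℝ → ℝ) (c a : ℝ) (p v w : Amb n) :
    warpedMetric f c p (a • v) w = a * warpedMetric f c p v w := by
  simp only [warpedMetric, Prod.smul_fst, Prod.smul_snd, quadricForm_smul_left, smul_eq_mul]
  ring

/-- The metric of the warped product as a bilinear form. -/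
def warpedBilin {n : ℕ} (f : ℝ → ℝ) (c : ℝ) (p : Amb n) : Amb n →ₗ[ℝ] Amb n →ₗ[ℝ] ℝ :=
  LinearMap.mk₂ ℝ (warpedMetric f c p) (warpedMetric_add_left f c p)
    (fun a v w => warpedMetric_smul_left f c a p v w)
    (fun u v w => by
      simp only [warpedMetric_comm f c p u, warpedMetric_add_left])
    (fun a v w => by
      simp only [warpedMetric_comm f c p v, warpedMetric_smul_left, smul_eq_mul])

@[simp] theorem warpedBilin_apply {n : ℕ} (f : ℝ → ℝ) (c : ℝ) (p v w : Amb n) :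
    warpedBilin f c p v w = warpedMetric f c p v w := rfl

theorem warpedBilin_comm {n : ℕ} (f : ℝ → ℝ) (c : ℝ) (p v w : Amb n) :
    warpedBilin f c p v w = warpedBilin f c p w v := warpedMetric_comm f c p v w

theorem warpedBilin_vertical {n : ℕ} (f : ℝ → ℝ) (c : ℝ) (p w : Amb n) :
    warpedBilin f c p (1, 0) w = w.1 := by
  simp [warpedMetric, quadricForm_zero_left]

/-- The Christoffel correction of the warped product as a bilinear map. -/
def warpedGammaBilin {n : ℕ} (f : ℝ → ℝ) (c : ℝ) (p : Amb n) : Amb n →ₗ[ℝ] Amb n →ₗ[ℝ] Amb n :=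
  LinearMap.mk₂ ℝ (warpedGamma f c p)
    (fun u v w => by
      ext1
      · simp only [warpedGamma, Prod.snd_add, quadricForm_add_left, Prod.fst_add]
        ring
      · simp only [warpedGamma, Prod.snd_add, quadricForm_add_left, Prod.fst_add]
        module)
    (fun a v w => by
      ext1
      · simp only [warpedGamma, Prod.smul_fst, Prod.smul_snd, quadricForm_smul_left, smul_eq_mul]
        ring
      · simp only [warpedGamma, Prod.smul_fst, Prod.smul_snd, quadricForm_smul_left, smul_eq_mul]
        module)
    (fun u v w => by
      simp only [quadricForm_comm c u.2, warpedGamma]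
      ext1
      · simp only [Prod.snd_add, quadricForm_add_left, Prod.fst_add]
        ring
      · simp only [Prod.snd_add, quadricForm_add_left, Prod.fst_add]
        module)
    (fun a v w => by
      simp only [quadricForm_comm c v.2, warpedGamma]
      ext1
      · simp only [Prod.smul_fst, Prod.smul_snd, quadricForm_smul_left, smul_eq_mul]
        ring
      · simp only [Prod.smul_fst, Prod.smul_snd, quadricForm_smul_left, smul_eq_mul]
        module)

@[simp] theorem warpedGammaBilin_apply {n : ℕ} (f : ℝ → ℝ) (c : ℝ) (p v w : Amb n) :
    warpedGammaBilin f c p v w = warpedGamma f c p v w := rfl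

/-- `∇_v ∂_t = (f' / f) (v - ⟨∂_t, v⟩ ∂_t)`. -/
theorem warpedGamma_vertical {n : ℕ} (f : ℝ → ℝ) (c : ℝ) (p v : Amb n) :
    warpedGamma f c p v (1, 0) = (deriv f p.1 / f p.1) • (v - v.1 • ((1, 0) : Amb n)) := by
  ext1 <;> simp [warpedGamma, quadricForm_comm c v.2, quadricForm_zero_left]

/-- The linear form whose kernel is the tangent space of the space form at `q`. -/
def tangentForm {n : ℕ} (c : ℝ) (q : EuclideanSpace ℝ (Fin (n + 1))) :
    EuclideanSpace ℝ (Fin (n + 1)) →ₗ[ℝ] ℝ where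
  toFun v := q 0 * v 0 + c * ∑ i : Fin n, q i.succ * v i.succ
  map_add' v w := by
    simp only [PiLp.add_apply, mul_add, Finset.sum_add_distrib]
    ring
  map_smul' a v := by
    simp only [PiLp.smul_apply, smul_eq_mul, RingHom.id_apply, mul_add, Finset.mul_sum]
    congr 1
    · ring
    · exact Finset.sum_congr rfl fun i _ => by ring

/-- The tangent space of the warped product at `p`. -/
def warpedTangent {n : ℕ} (c : ℝ) (p : Amb n) : Submodule ℝ (Amb n) :=
  LinearMap.ker (tangentForm c p.2 ∘ₗ LinearMap.snd ℝ ℝ _)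

theorem mem_warpedTangent {n : ℕ} {c : ℝ} {p v : Amb n} :
    v ∈ warpedTangent c p ↔ IsTangentSpaceForm c p.2 v.2 := Iff.rfl

/-- The equation of the space form says that the tangent form takes the value 1 on the position
vector. It is therefore nonzero, and its kernel has codimension one in dimension `n + 2`. -/
theorem finrank_warpedTangent {n : ℕ} {c : ℝ} {I : Set ℝ} {p : Amb n}
    (hp : p ∈ warpedProduct n I c) : Module.finrank ℝ (warpedTangent c p) = n + 1 := by
  have h1 : (tangentForm c p.2 ∘ₗ LinearMap.snd ℝ ℝ _) (0, p.2) = 1 := by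
    have := hp.2.1
    simp only [LinearMap.comp_apply, LinearMap.snd_apply, tangentForm, LinearMap.coe_mk,
      AddHom.coe_mk, ← sq]
    exact this
  have h2 : LinearMap.range (tangentForm c p.2 ∘ₗ LinearMap.snd ℝ ℝ _) = ⊤ := by
    refine LinearMap.range_eq_top.2 fun a => ⟨a • (0, p.2), ?_⟩
    rw [map_smul, h1]
    simp
  have h3 := LinearMap.finrank_range_add_finrank_ker
    (tangentForm c p.2 ∘ₗ LinearMap.snd ℝ ℝ (EuclideanSpace ℝ (Fin (n + 1))))
  rw [h2, finrank_top, Module.finrank_self, Module.finrank_prod, Module.finrank_self,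
    finrank_euclideanSpace_fin] at h3
  change Module.finrank ℝ (LinearMap.ker (tangentForm c p.2 ∘ₗ LinearMap.snd ℝ ℝ _)) = n + 1
  omega

/-- Only `c = -1` needs an argument: tangency and Cauchy–Schwarz give `q₀² v₀² ≤ (q₀² - 1) ∑ vᵢ²`,
so the spatial part of `v` dominates `v₀`. For `c = 0` tangency forces `v₀ = 0`, and for `c = 1` the
form is Euclidean. -/
theorem quadricForm_pos {n : ℕ} {c : ℝ} (hc : c = -1 ∨ c = 0 ∨ c = 1)
    {q v : EuclideanSpace ℝ (Fin (n + 1))} (hq : q ∈ spaceForm n c)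
    (hv : IsTangentSpaceForm c q v) (hne : v ≠ 0) : 0 < quadricForm c v v := by
  have hq1 := hq.1
  have hcases : v 0 ≠ 0 ∨ 0 < ∑ i : Fin n, v i.succ ^ 2 := by
    by_contra! h
    have h2 := (Finset.sum_eq_zero_iff_of_nonneg fun (i : Fin n) _ => sq_nonneg (v i.succ)).1
      (le_antisymm h.2 (Finset.sum_nonneg fun i _ => sq_nonneg _))
    refine hne (PiLp.ext fun i => ?_)
    refine Fin.cases h.1 (fun j => ?_) i
    exact pow_eq_zero_iff (two_ne_zero) |>.1 (h2 j (Finset.mem_univ j))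
  have hs : 0 ≤ ∑ i : Fin n, v i.succ ^ 2 := Finset.sum_nonneg fun i _ => sq_nonneg _
  have hcs := Finset.sum_mul_sq_le_sq_mul_sq Finset.univ (fun i : Fin n => q i.succ)
    fun i => v i.succ
  simp only [IsTangentSpaceForm] at hv
  simp only [quadricForm, ← sq]
  rcases hc with rfl | rfl | rfl
  · have e : ∑ i : Fin n, q i.succ * v i.succ = q 0 * v 0 := by linarith
    have e2 : ∑ i : Fin n, q i.succ ^ 2 = q 0 ^ 2 - 1 := by linarith
    rw [e, e2] at hcs
    have h0 := hq.2 (by norm_num)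
    have hS : 0 < ∑ i : Fin n, v i.succ ^ 2 := by
      rcases hcases with h | h
      · by_contra! h'
        have : ∑ i : Fin n, v i.succ ^ 2 = 0 := le_antisymm h' hs
        rw [this] at hcs
        have := sq_pos_of_ne_zero (mul_ne_zero h0.ne' h)
        linarith
      · exact h
    have : 0 < q 0 ^ 2 * (∑ i : Fin n, v i.succ ^ 2 - v 0 ^ 2) := by nlinarith
    have := pos_of_mul_pos_right this (sq_nonneg _)
    linarith
  · have h0 := hq.2 le_rfl
    have : v 0 = 0 := by simpa [h0.ne'] using hv
    simpa [this] using hcases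
  · rcases hcases with h | h
    · have := sq_pos_of_ne_zero h
      linarith
    · have := sq_nonneg (v 0)
      linarith

theorem warpedBilin_pos {n : ℕ} {f : ℝ → ℝ} {c : ℝ} (hc : c = -1 ∨ c = 0 ∨ c = 1) {I : Set ℝ}
    (hfpos : ∀ t ∈ I, 0 < f t) {p v : Amb n} (hp : p ∈ warpedProduct n I c)
    (hv : v ∈ warpedTangent c p) (hne : v ≠ 0) : 0 < warpedBilin f c p v v := by
  simp only [warpedBilin_apply, warpedMetric, ← sq]
  have hf2 := pow_pos (hfpos _ hp.1) 2
  by_cases h2 : v.2 = 0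
  · have h1 : v.1 ≠ 0 := fun h1 => hne (Prod.ext h1 h2)
    rw [h2, quadricForm_zero_left, mul_zero, add_zero]
    exact sq_pos_of_ne_zero h1
  · have : 0 < f p.1 ^ 2 * quadricForm c v.2 v.2 := mul_pos hf2 (quadricForm_pos hc hp.2 hv h2)
    have := sq_nonneg v.1
    linarith

/-- A tangent vector of the warped product is the sum of its components along a tangent hyperplane
`range L` and its unit normal `ν`. -/
theorem exists_add_normal {n : ℕ} {f : ℝ → ℝ} {c : ℝ} {I : Set ℝ} {p ν : Amb n}
    {E : Type*} [AddCommGroup E] [Module ℝ E] [FiniteDimensional ℝ E]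
    (hE : Module.finrank ℝ E = n) (hp : p ∈ warpedProduct n I c) (L : E →ₗ[ℝ] Amb n)
    (hL : Function.Injective L) (hLt : ∀ v, L v ∈ warpedTangent c p)
    (hν : ν ∈ warpedTangent c p) (hν1 : warpedBilin f c p ν ν = 1)
    (horth : ∀ v, warpedBilin f c p ν (L v) = 0) {z : Amb n} (hz : z ∈ warpedTangent c p) :
    ∃ u, z = L u + warpedBilin f c p z ν • ν := by
  -- `K (v, a) = L v + a ν`. Pairing with `ν` recovers `a`, so `K` is injective; both sides have
  -- dimension `n + 1`, so it is onto.
  let K : (E × ℝ) →ₗ[ℝ] warpedTangent c p :=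
    (L.coprod (LinearMap.toSpanSingleton ℝ _ ν)).codRestrict _ fun w => by
      simpa using add_mem (hLt w.1) (Submodule.smul_mem _ w.2 hν)
  have hKv : ∀ w, (K w : Amb n) = L w.1 + w.2 • ν := fun w => by simp [K]
  have hin : ∀ w, warpedBilin f c p (K w) ν = w.2 := fun w => by
    rw [hKv, map_add, LinearMap.add_apply, warpedBilin_comm, horth, map_smul, LinearMap.smul_apply,
      hν1]
    simp
  have hKi : Function.Injective K := by
    rw [← LinearMap.ker_eq_bot, LinearMap.ker_eq_bot']
    intro w hw
    have h2 := hin w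
    rw [hw] at h2
    have h2 : w.2 = 0 := by simpa using h2.symm
    have h1 := hKv w
    rw [hw, h2] at h1
    have h1 : L w.1 = 0 := by simpa using h1.symm
    exact Prod.ext (hL (by rw [h1]; simp)) h2
  have hKs : Function.Surjective K :=
    (LinearMap.injective_iff_surjective_of_finrank_eq_finrank (by
      rw [finrank_warpedTangent hp, Module.finrank_prod, hE, Module.finrank_self])).1 hKi
  obtain ⟨w, hw⟩ := hKs ⟨z, hz⟩
  have h2 := hin w
  have h1 := hKv w
  rw [hw] at h1 h2
  refine ⟨w.1, ?_⟩
  rw [h2]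
  exact h1

/-- `representer` takes bare functions; this lemma and the next apply it to functions that agree
with a positive definite bilinear form. -/
theorem representer_eq {W : Type*} [AddCommGroup W] [Module ℝ W] [FiniteDimensional ℝ W]
    {g : W → W → ℝ} (B : W →ₗ[ℝ] W →ₗ[ℝ] ℝ) (hg : ∀ v w, g v w = B v w)
    (hB : ∀ w, w ≠ 0 → 0 < B w w) {a : W → ℝ} (u : W) (hu : ∀ w, g u w = a w) :
    representer g a = u := by
  have hgB : g = fun v w => B v w := funext fun v => funext fun w => hg v w
  have ha : a = fun w => B u w := funext fun w => by rw [← hu, hg]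
  rw [hgB, ha]
  exact ((representer_spec B hB (B u)).2 u fun _ => rfl).symm

theorem representer_apply {W : Type*} [AddCommGroup W] [Module ℝ W] [FiniteDimensional ℝ W]
    {g : W → W → ℝ} (B : W →ₗ[ℝ] W →ₗ[ℝ] ℝ) (hg : ∀ v w, g v w = B v w)
    (hB : ∀ w, w ≠ 0 → 0 < B w w) {a : W → ℝ} (α : W →ₗ[ℝ] ℝ) (ha : ∀ w, a w = α w) (w : W) :
    g (representer g a) w = a w := by
  have hgB : g = fun v w => B v w := funext fun v => funext fun w => hg v w
  rw [show a = fun w => α w from funext ha, hgB]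
  exact (representer_spec B hB α).1 w

/-! ## Calculus in a parametrization -/

section Flat

variable {n : ℕ} {E : Type*} [NormedAddCommGroup E] [NormedSpace ℝ E]

/-- The covariant derivative in the direction `v` of the field `Z` along the map `X` into the warped
product. -/
def covAlong (f : ℝ → ℝ) (c : ℝ) (X Z : E → Amb n) (y v : E) : Amb n :=
  fderiv ℝ Z y v + warpedGammaBilin f c (X y) (fderiv ℝ X y v) (Z y)

/-- Differentiate the equation of the quadric along the line `y + s v`. -/
theorem fderiv_mem_warpedTangent {I : Set ℝ} {c : ℝ} {X : E → Amb n}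
    (hX : ∀ y, X y ∈ warpedProduct n I c) (y v : E) :
    fderiv ℝ X y v ∈ warpedTangent c (X y) := by
  by_cases hd : DifferentiableAt ℝ X y
  · have hl : HasDerivAt (fun s : ℝ => y + s • v) v 0 := by
      simpa using ((hasDerivAt_id (0 : ℝ)).smul_const v).const_add y
    have hp : HasDerivAt (fun s : ℝ => X (y + s • v)) (fderiv ℝ X y v) 0 := by
      have h1 : HasFDerivAt X (fderiv ℝ X y) (y + (0 : ℝ) • v) := by simpa using hd.hasFDerivAt
      exact h1.comp_hasDerivAt (0 : ℝ) hl
    have hq : HasDerivAt (fun s : ℝ => (X (y + s • v)).2 0 ^ 2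
        + c * ∑ i : Fin n, (X (y + s • v)).2 i.succ ^ 2) _ 0 :=
      ((hasDerivAt_coord hp 0).pow 2).add
        ((HasDerivAt.fun_sum fun (i : Fin n) _ => (hasDerivAt_coord hp i.succ).pow 2).const_mul c)
    rw [show (fun s : ℝ => (X (y + s • v)).2 0 ^ 2
        + c * ∑ i : Fin n, (X (y + s • v)).2 i.succ ^ 2) = fun _ => 1 from
      funext fun s => (hX _).2.1] at hq
    have e := hq.unique (hasDerivAt_const (0 : ℝ) (1 : ℝ))
    simp only [zero_smul, add_zero, Nat.cast_ofNat, Nat.add_one_sub_one, pow_one, mul_assoc] at e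
    rw [← Finset.mul_sum] at e
    rw [mem_warpedTangent, IsTangentSpaceForm]
    linarith
  -- The default derivative 0 is tangent as well, so no differentiability has to be assumed.
  · rw [fderiv_zero_of_not_differentiableAt hd]
    exact zero_mem _

theorem differentiableAt_warpedBilin {f : ℝ → ℝ} (c : ℝ) {X W Z : E → Amb n} {y : E}
    (hf : DifferentiableAt ℝ f (X y).1) (hX : DifferentiableAt ℝ X y)
    (hW : DifferentiableAt ℝ W y) (hZ : DifferentiableAt ℝ Z y) :
    DifferentiableAt ℝ (fun y => warpedBilin f c (X y) (W y) (Z y)) y := by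
  have hco : ∀ {V : E → Amb n}, DifferentiableAt ℝ V y → ∀ i : Fin (n + 1),
      DifferentiableAt ℝ (fun y => (V y).2 i) y := fun {V} hV i =>
    (EuclideanSpace.proj (𝕜 := ℝ) i).differentiableAt.comp y hV.snd
  have hfX : DifferentiableAt ℝ (fun y => f (X y).1) y := hf.comp y hX.fst
  have hsum : DifferentiableAt ℝ (fun y => ∑ i : Fin n, (W y).2 i.succ * (Z y).2 i.succ) y :=
    DifferentiableAt.fun_sum fun i _ => (hco hW i.succ).mul (hco hZ i.succ)
  exact (hW.fst.mul hZ.fst).add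
    ((hfX.pow 2).mul ((((hco hW 0).mul (hco hZ 0)).const_mul c).add hsum))

/-- Metric compatibility along the curve `s ↦ X (y + s v)`, evaluated at `s = 0`. -/
theorem fderiv_warpedBilin {f : ℝ → ℝ} {c : ℝ} (hc : c = -1 ∨ c = 0 ∨ c = 1) {X W Z : E → Amb n}
    {y : E} (hf : DifferentiableAt ℝ f (X y).1) (hf0 : f (X y).1 ≠ 0)
    (hX : DifferentiableAt ℝ X y) (hW : DifferentiableAt ℝ W y) (hZ : DifferentiableAt ℝ Z y)
    (hWt : W y ∈ warpedTangent c (X y)) (hZt : Z y ∈ warpedTangent c (X y)) (v : E) :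
    fderiv ℝ (fun y => warpedBilin f c (X y) (W y) (Z y)) y v
      = warpedBilin f c (X y) (covAlong f c X W y v) (Z y)
        + warpedBilin f c (X y) (W y) (covAlong f c X Z y v) := by
  have hl : HasDerivAt (fun s : ℝ => y + s • v) v 0 := by
    simpa using ((hasDerivAt_id (0 : ℝ)).smul_const v).const_add y
  have key : ∀ {F : Type _} [NormedAddCommGroup F] [NormedSpace ℝ F] {V : E → F},
      DifferentiableAt ℝ V y → HasDerivAt (fun s : ℝ => V (y + s • v)) (fderiv ℝ V y v) 0 := by
    intro F _ _ V hV
    have h1 : HasFDerivAt V (fderiv ℝ V y) (y + (0 : ℝ) • v) := by simpa using hV.hasFDerivAt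
    exact h1.comp_hasDerivAt (0 : ℝ) hl
  have h1 := key (differentiableAt_warpedBilin c hf hX hW hZ)
  have h2 := warpedGamma_metric f hc _ _ _ _ _ _ 0 (key hX) (key hW) (key hZ)
    (by simpa using hf) (by simpa using hf0)
    (by simpa only [zero_smul, add_zero] using! hWt)
    (by simpa only [zero_smul, add_zero] using! hZt)
  simpa only [zero_smul, add_zero] using! h1.unique h2

/-- The Koszul formula: the Christoffel symbols of the metric induced by the parametrization `X` are
the tangential part of the covariant derivatives of its coordinate fields. -/
theorem half_fderiv_inducedMetric {f : ℝ → ℝ} {c : ℝ} (hc : c = -1 ∨ c = 0 ∨ c = 1) {I : Set ℝ}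
    {X : E → Amb n} (hXI : ∀ y, X y ∈ warpedProduct n I c) {y : E}
    (hf : DifferentiableAt ℝ f (X y).1) (hf0 : f (X y).1 ≠ 0) (hX : ContDiffAt ℝ 2 X y)
    (v w z : E) :
    (1 / 2 : ℝ) *
      (fderiv ℝ (fun y => warpedBilin f c (X y) (fderiv ℝ X y w) (fderiv ℝ X y z)) y v
      + fderiv ℝ (fun y => warpedBilin f c (X y) (fderiv ℝ X y v) (fderiv ℝ X y z)) y w
      - fderiv ℝ (fun y => warpedBilin f c (X y) (fderiv ℝ X y v) (fderiv ℝ X y w)) y z)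
    = warpedBilin f c (X y) (fderiv ℝ (fderiv ℝ X) y v w
        + warpedGammaBilin f c (X y) (fderiv ℝ X y v) (fderiv ℝ X y w)) (fderiv ℝ X y z) := by
  have hdX : DifferentiableAt ℝ X y := hX.differentiableAt (by norm_num)
  have hd2 : DifferentiableAt ℝ (fderiv ℝ X) y :=
    (hX.fderiv_right (m := 1) (by norm_num)).differentiableAt (by norm_num)
  have hd (a : E) : DifferentiableAt ℝ (fun y => fderiv ℝ X y a) y :=
    hd2.clm_apply (differentiableAt_const a)
  have hsymm := hX.isSymmSndFDerivAt (by simp)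
  have hcov (a b : E) : covAlong f c X (fun y => fderiv ℝ X y a) y b
      = fderiv ℝ (fderiv ℝ X) y b a
        + warpedGammaBilin f c (X y) (fderiv ℝ X y b) (fderiv ℝ X y a) := by
    rw [covAlong, fderiv_clm_apply hd2 (differentiableAt_const a)]
    simp
  -- Torsion-freeness: the second derivative of `X` and `warpedGamma` are both symmetric. After the
  -- product rule, four of the six terms cancel and the other two are equal.
  have hcs (a b : E) : covAlong f c X (fun y => fderiv ℝ X y a) y b
      = covAlong f c X (fun y => fderiv ℝ X y b) y a := by
    rw [hcov, hcov, hsymm b a]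
    simp only [warpedGammaBilin_apply, warpedGamma_symm f c (X y) (fderiv ℝ X y b)]
  have ht := fderiv_mem_warpedTangent hXI y
  rw [fderiv_warpedBilin hc hf hf0 hdX (hd w) (hd z) (ht w) (ht z),
    fderiv_warpedBilin hc hf hf0 hdX (hd v) (hd z) (ht v) (ht z),
    fderiv_warpedBilin hc hf hf0 hdX (hd v) (hd w) (ht v) (ht w), ← hcov, hcs v w, hcs v z, hcs w z,
    warpedBilin_comm f c (X y) (fderiv ℝ X y w), warpedBilin_comm f c (X y) (fderiv ℝ X y v)]
  ring

/-- The second fundamental form with respect to a normal field is symmetric. -/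
theorem warpedBilin_covAlong_normal_symm {f : ℝ → ℝ} {c : ℝ} (hc : c = -1 ∨ c = 0 ∨ c = 1)
    {I : Set ℝ} {X ν : E → Amb n} (hXI : ∀ y, X y ∈ warpedProduct n I c) {y : E}
    (hf : DifferentiableAt ℝ f (X y).1) (hf0 : f (X y).1 ≠ 0) (hX : ContDiffAt ℝ 2 X y)
    (hν : DifferentiableAt ℝ ν y) (hνt : ν y ∈ warpedTangent c (X y))
    (horth : ∀ w, ∀ᶠ y in 𝓝 y, warpedBilin f c (X y) (ν y) (fderiv ℝ X y w) = 0) (v w : E) :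
    warpedBilin f c (X y) (covAlong f c X ν y v) (fderiv ℝ X y w)
      = warpedBilin f c (X y) (covAlong f c X ν y w) (fderiv ℝ X y v) := by
  have hdX : DifferentiableAt ℝ X y := hX.differentiableAt (by norm_num)
  have hd2 : DifferentiableAt ℝ (fderiv ℝ X) y :=
    (hX.fderiv_right (m := 1) (by norm_num)).differentiableAt (by norm_num)
  have hsymm := hX.isSymmSndFDerivAt (by simp)
  -- Differentiating `⟨ν, ∂_b X⟩ = 0` moves the derivative from `ν` to `∂_b X`, where it is
  -- symmetric in `a` and `b`.
  have key (a b : E) : warpedBilin f c (X y) (covAlong f c X ν y a) (fderiv ℝ X y b)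
      = - warpedBilin f c (X y) (ν y) (fderiv ℝ (fderiv ℝ X) y a b
        + warpedGammaBilin f c (X y) (fderiv ℝ X y a) (fderiv ℝ X y b)) := by
    have h := fderiv_warpedBilin hc hf hf0 hdX hν (hd2.clm_apply (differentiableAt_const b)) hνt
      (fderiv_mem_warpedTangent hXI y b) a
    rw [Filter.EventuallyEq.fderiv_eq (f := fun _ => (0 : ℝ)) (horth b), fderiv_fun_const] at h
    have hcov : covAlong f c X (fun y => fderiv ℝ X y b) y a
        = fderiv ℝ (fderiv ℝ X) y a b
          + warpedGammaBilin f c (X y) (fderiv ℝ X y a) (fderiv ℝ X y b) := by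
      rw [covAlong, fderiv_clm_apply hd2 (differentiableAt_const b)]
      simp
    rw [← hcov]
    simp only [Pi.zero_apply, _root_.zero_apply] at h
    linarith
  rw [key, key, hsymm v w]
  simp only [warpedGammaBilin_apply, warpedGamma_symm f c (X y) (fderiv ℝ X y v)]

theorem covAlong_smul (f : ℝ → ℝ) (c : ℝ) {X Z : E → Amb n} {a : E → ℝ} {y : E}
    (ha : DifferentiableAt ℝ a y) (hZ : DifferentiableAt ℝ Z y) (v : E) :
    covAlong f c X (fun y => a y • Z y) y v
      = fderiv ℝ a y v • Z y + a y • covAlong f c X Z y v := by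
  rw [covAlong, covAlong, fderiv_fun_smul ha hZ]
  simp only [_root_.add_apply, _root_.smul_apply,
    ContinuousLinearMap.smulRight_apply, map_smul, smul_add]
  abel

theorem covAlong_sub (f : ℝ → ℝ) (c : ℝ) {X Z W : E → Amb n} {y : E}
    (hZ : DifferentiableAt ℝ Z y) (hW : DifferentiableAt ℝ W y) (v : E) :
    covAlong f c X (fun y => Z y - W y) y v = covAlong f c X Z y v - covAlong f c X W y v := by
  rw [covAlong, covAlong, covAlong, fderiv_fun_sub hZ hW]
  simp only [_root_.sub_apply, map_sub]
  abel

theorem covAlong_vertical (f : ℝ → ℝ) (c : ℝ) (X : E → Amb n) (y v : E) :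
    covAlong f c X (fun _ => (1, 0)) y v
      = (deriv f (X y).1 / f (X y).1) •
          (fderiv ℝ X y v - (fderiv ℝ X y v).1 • ((1, 0) : Amb n)) := by
  rw [covAlong, fderiv_fun_const, warpedGammaBilin_apply, warpedGamma_vertical]
  simp

/-- A field that is mapped to a smooth field by a smooth family of injective linear maps is
smooth. -/
theorem contDiffAt_of_clm_apply {F : Type*} [NormedAddCommGroup F] [NormedSpace ℝ F]
    [FiniteDimensional ℝ F] {G : Type*} [NormedAddCommGroup G] [NormedSpace ℝ G]
    [FiniteDimensional ℝ G] {k : ℕ∞ω} {L : E → F →L[ℝ] G} {u : E → F} {y : E}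
    (hL : ContDiffAt ℝ k L y) (hinj : Function.Injective (L y))
    (hu : ContDiffAt ℝ k (fun y => L y (u y)) y) : ContDiffAt ℝ k u y := by
  -- A left inverse `R` at the single point `y` suffices: `R ∘ L z` is the identity at `z = y`,
  -- hence invertible nearby, and `u z = (R ∘ L z)⁻¹ (R (L z (u z)))`, where inversion of operators
  -- is smooth.
  obtain ⟨R, hR⟩ := LinearMap.exists_leftInverse_of_injective (L y : F →ₗ[ℝ] G)
    (LinearMap.ker_eq_bot.2 hinj)
  let R' : G →L[ℝ] F := LinearMap.toContinuousLinearMap R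
  have h1 : ContDiffAt ℝ k (fun z => R'.comp (L z)) y := contDiffAt_const.clm_comp hL
  have hid : R'.comp (L y) = (ContinuousLinearEquiv.refl ℝ F : F →L[ℝ] F) := by
    ext w
    exact LinearMap.congr_fun hR w
  have : CompleteSpace F := FiniteDimensional.complete ℝ F
  have h2 : ContDiffAt ℝ k (fun z => (R'.comp (L z)).inverse) y := by
    have h := contDiffAt_map_inverse (n := k) (ContinuousLinearEquiv.refl ℝ F)
    rw [← hid] at h
    exact h.comp y h1
  have h3 : ContDiffAt ℝ k (fun z => (R'.comp (L z)).inverse (R' (L z (u z)))) y :=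
    h2.clm_apply (contDiffAt_const.clm_apply hu)
  refine h3.congr_of_eventuallyEq ?_
  have hev : ∀ᶠ z in 𝓝 y, R'.comp (L z) ∈ range ((↑) : (F ≃L[ℝ] F) → F →L[ℝ] F) :=
    h1.continuousAt.eventually_mem (by
      rw [hid]
      exact ContinuousLinearEquiv.nhds _)
  filter_upwards [hev] with z hz
  obtain ⟨e, he⟩ := hz
  have : R' (L z (u z)) = e (u z) := by
    have := congrArg (fun T : F →L[ℝ] F => T (u z)) he
    exact this.symm
  rw [this, ← he, ContinuousLinearMap.inverse_equiv]
  simp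

/-- If `dθ = -h dp`, then `dh ∧ dp = 0`. -/
theorem fderiv_mul_fderiv_symm {θ p h : E → ℝ} {y : E} (hθ : ContDiffAt ℝ 2 θ y)
    (hp : ContDiffAt ℝ 2 p y) (hh : DifferentiableAt ℝ h y)
    (heq : ∀ᶠ z in 𝓝 y, fderiv ℝ θ z = -(h z • fderiv ℝ p z)) (v w : E) :
    fderiv ℝ h y v * fderiv ℝ p y w = fderiv ℝ h y w * fderiv ℝ p y v := by
  have hp2 : DifferentiableAt ℝ (fderiv ℝ p) y :=
    (hp.fderiv_right (m := 1) (by norm_num)).differentiableAt (by norm_num)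
  have hs1 := hθ.isSymmSndFDerivAt (by simp) v w
  have hs2 := hp.isSymmSndFDerivAt (by simp) v w
  -- The second derivative of `θ` becomes `-(dh ⊗ dp + h D²p)`; as it and `D²p` are symmetric, so is
  -- `dh ⊗ dp`.
  rw [Filter.EventuallyEq.fderiv_eq heq, fderiv_fun_neg, fderiv_fun_smul hh hp2] at hs1
  simp only [_root_.neg_apply, _root_.add_apply, _root_.smul_apply,
    ContinuousLinearMap.smulRight_apply, smul_eq_mul] at hs1
  linear_combination (-1 : ℝ) * hs1 - h y * hs2

/-- A function whose differential is everywhere proportional to that of a submersion is locally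
constant on the fibres of the submersion. -/
theorem exists_nhds_eq_of_fderiv_proportional [CompleteSpace E] {h p : E → ℝ} {y : E}
    (hp : ContDiffAt ℝ 1 p y) (hne : fderiv ℝ p y ≠ 0)
    (hh : ∀ᶠ z in 𝓝 y, DifferentiableAt ℝ h z ∧ DifferentiableAt ℝ p z ∧
      ∃ k : ℝ, fderiv ℝ h z = k • fderiv ℝ p z) :
    ∃ V ∈ 𝓝 y, ∀ a ∈ V, ∀ b ∈ V, p a = p b → h a = h b := by
  obtain ⟨e, he⟩ : ∃ e, fderiv ℝ p y e = 1 := by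
    obtain ⟨e, he⟩ : ∃ e, fderiv ℝ p y e ≠ 0 := by
      by_contra! h0
      exact hne (ContinuousLinearMap.ext h0)
    exact ⟨(fderiv ℝ p y e)⁻¹ • e, by rw [map_smul, smul_eq_mul, inv_mul_cancel₀ he]⟩
  set l := fderiv ℝ p y with hl
  -- Correcting `z` along `e`, where `l e = 1`, makes `l ∘ Φ = p` exact, while the derivative of `Φ`
  -- at `y` is the identity. In the coordinates given by `Φ`, `p` is the linear form `l`.
  let Φ : E → E := fun z => z + (p z - l z) • e
  have hΦ : ContDiffAt ℝ 1 Φ y :=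
    contDiffAt_id.add ((hp.sub l.contDiff.contDiffAt).smul contDiffAt_const)
  have hlΦ : ∀ z, l (Φ z) = p z := fun z => by
    simp [Φ, he]
  have hpd := (hp.differentiableAt (by norm_num)).hasFDerivAt
  have hΦ' : HasFDerivAt Φ ((ContinuousLinearEquiv.refl ℝ E : E ≃L[ℝ] E) : E →L[ℝ] E) y := by
    have h1 := (hasFDerivAt_id y).add ((hpd.sub l.hasFDerivAt).smul_const e)
    convert! h1 using 1
    ext w
    simp [← hl]
  let Ψ := hΦ.toOpenPartialHomeomorph Φ hΦ' one_ne_zero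
  have hyS : y ∈ Ψ.source := hΦ.mem_toOpenPartialHomeomorph_source hΦ' one_ne_zero
  have hΨ : ∀ z, Ψ z = Φ z := fun z => rfl
  have hyT : Φ y ∈ Ψ.target := Ψ.map_source hyS
  have hsy : Ψ.symm (Φ y) = y := Ψ.left_inv hyS
  have hsd : ContDiffAt ℝ 1 Ψ.symm (Φ y) := by
    refine Ψ.contDiffAt_symm (f₀' := ContinuousLinearEquiv.refl ℝ E) hyT ?_ ?_
    · rw [hsy]
      exact hΦ'
    · rw [hsy]
      exact hΦ
  have hev : ∀ᶠ x in 𝓝 (Φ y), x ∈ Ψ.target ∧ DifferentiableAt ℝ Ψ.symm x ∧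
      DifferentiableAt ℝ h (Ψ.symm x) ∧ DifferentiableAt ℝ p (Ψ.symm x) ∧
      ∃ k : ℝ, fderiv ℝ h (Ψ.symm x) = k • fderiv ℝ p (Ψ.symm x) := by
    have h1 : ∀ᶠ x in 𝓝 (Φ y), ContDiffAt ℝ 1 Ψ.symm x := hsd.eventually (by simp)
    have h2 : Filter.Tendsto Ψ.symm (𝓝 (Φ y)) (𝓝 y) := by
      have := hsd.continuousAt.tendsto
      rwa [hsy] at this
    filter_upwards [Ψ.open_target.mem_nhds hyT, h1, h2.eventually hh] with x hx1 hx2 hx3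
    exact ⟨hx1, hx2.differentiableAt (by norm_num), hx3⟩
  obtain ⟨r, hr, hball⟩ := Metric.eventually_nhds_iff_ball.1 hev
  refine ⟨Ψ.source ∩ Φ ⁻¹' Metric.ball (Φ y) r, Filter.inter_mem (Ψ.open_source.mem_nhds hyS)
    (hΦ.continuousAt.preimage_mem_nhds (Metric.ball_mem_nhds _ hr)), ?_⟩
  rintro a ⟨ha, ha'⟩ b ⟨hb, hb'⟩ hab
  -- In these coordinates the fibres of `p` are affine, so the segment from `Φ a` to `Φ b` stays in
  -- one fibre and in the convex ball; the derivative of `h` along it vanishes.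
  have hseg : ∀ s ∈ Icc (0 : ℝ) 1, Φ a + s • (Φ b - Φ a) ∈ Metric.ball (Φ y) r := fun s hs =>
    (convex_ball (Φ y) r).add_smul_sub_mem ha' hb' hs
  have hder : ∀ s ∈ Icc (0 : ℝ) 1,
      HasDerivAt (fun s : ℝ => h (Ψ.symm (Φ a + s • (Φ b - Φ a)))) 0 s := by
    intro s hs
    obtain ⟨hxT, hxd, hxh, hxp, k, hk⟩ := hball _ (hseg s hs)
    set x := Φ a + s • (Φ b - Φ a)
    have hline : HasDerivAt (fun s : ℝ => Φ a + s • (Φ b - Φ a)) (Φ b - Φ a) s := by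
      simpa using ((hasDerivAt_id s).smul_const (Φ b - Φ a)).const_add (Φ a)
    have hc := hxd.hasFDerivAt.comp_hasDerivAt s hline
    have hch := hxh.hasFDerivAt.comp_hasDerivAt s hc
    have hpc := hxp.hasFDerivAt.comp x hxd.hasFDerivAt
    have hpl : HasFDerivAt (p ∘ Ψ.symm) l x := by
      refine l.hasFDerivAt.congr_of_eventuallyEq ?_
      filter_upwards [Ψ.open_target.mem_nhds hxT] with z hz
      rw [Function.comp_apply, ← hlΦ, ← hΨ, Ψ.right_inv hz]
    have hu := congrArg (fun T : E →L[ℝ] ℝ => T (Φ b - Φ a)) (hpc.unique hpl)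
    have hab' : l (Φ b - Φ a) = 0 := by rw [map_sub, hlΦ, hlΦ, hab, sub_self]
    simp only [ContinuousLinearMap.comp_apply, hab'] at hu
    rw [hk, _root_.smul_apply, hu, smul_zero] at hch
    exact hch
  have hconst := constant_of_has_deriv_right_zero
    (fun s hs => (hder s hs).continuousAt.continuousWithinAt)
    (fun s hs => (hder s (Ico_subset_Icc_self hs)).hasDerivWithinAt) 1 (right_mem_Icc.2 zero_le_one)
  simp only [one_smul, zero_smul, add_zero, add_sub_cancel] at hconst
  rw [← hΨ, ← hΨ, Ψ.left_inv ha, Ψ.left_inv hb] at hconst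
  exact hconst.symm

end Flat

/-! ## Fields along an immersion in charts -/

section Chart

variable {n : ℕ} {M : Type*} [TopologicalSpace M] [ChartedSpace (EuclideanSpace ℝ (Fin n)) M]

/-- The function `F` in the chart around `p`. -/
def inChart {V : Type*} (p : M) (F : M → V) (y : EuclideanSpace ℝ (Fin n)) : V :=
  F ((extChartAt (𝓡 n) p).symm y)

instance finiteDimensional_tangentSpace (x : M) : FiniteDimensional ℝ (TangentSpace (𝓡 n) x) :=
  inferInstanceAs (FiniteDimensional ℝ (EuclideanSpace ℝ (Fin n)))

/-- The identification of `T_x M` with the model space that the chart around `x` provides. -/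
def tangentModel (x : M) : TangentSpace (𝓡 n) x ≃ₗ[ℝ] EuclideanSpace ℝ (Fin n) where
  toFun v := v
  invFun v := v
  map_add' _ _ := rfl
  map_smul' _ _ := rfl
  left_inv _ := rfl
  right_inv _ := rfl

theorem inChart_self {V : Type*} (p : M) (F : M → V) :
    inChart p F (extChartAt (𝓡 n) p p) = F p := by
  rw [inChart, extChartAt_to_inv]

theorem inChart_eventually {p : M} {P : M → Prop} {x : M} (hx : x ∈ (extChartAt (𝓡 n) p).source)
    (hP : ∀ᶠ z in 𝓝 x, P z) :
    ∀ᶠ y in 𝓝 (extChartAt (𝓡 n) p x),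
      y ∈ (extChartAt (𝓡 n) p).target ∧ P ((extChartAt (𝓡 n) p).symm y) := by
  have hcont : ContinuousAt (extChartAt (𝓡 n) p).symm (extChartAt (𝓡 n) p x) :=
    continuousAt_extChartAt_symm'' ((extChartAt (𝓡 n) p).map_source hx)
  have h1 : Filter.Tendsto (extChartAt (𝓡 n) p).symm (𝓝 (extChartAt (𝓡 n) p x)) (𝓝 x) := by
    have := hcont.tendsto
    rwa [(extChartAt (𝓡 n) p).left_inv hx] at this
  exact Filter.Eventually.and (extChartAt_target_mem_nhds' ((extChartAt (𝓡 n) p).map_source hx))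
    (h1.eventually hP)

variable {V : Type*} [NormedAddCommGroup V] [NormedSpace ℝ V]

theorem contDiffAt_inChart [IsManifold (𝓡 n) ∞ M] {p x : M} {F : M → V}
    (hx : x ∈ (extChartAt (𝓡 n) p).source) (hF : ContMDiffAt (𝓡 n) 𝓘(ℝ, V) ∞ F x) :
    ContDiffAt ℝ ∞ (inChart p F) (extChartAt (𝓡 n) p x) := by
  rw [← contMDiffAt_iff_contDiffAt]
  have hy := (extChartAt (𝓡 n) p).map_source hx
  have h1 : ContMDiffAt 𝓘(ℝ, EuclideanSpace ℝ (Fin n)) (𝓡 n) ∞ (extChartAt (𝓡 n) p).symm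
      (extChartAt (𝓡 n) p x) :=
    (contMDiffOn_extChartAt_symm p).contMDiffAt (extChartAt_target_mem_nhds' hy)
  refine ContMDiffAt.comp (I' := 𝓡 n) (extChartAt (𝓡 n) p x) ?_ h1
  rwa [(extChartAt (𝓡 n) p).left_inv hx]

/-- Here `p` is the centre of its own chart, whose differential is the identity at `p`. Elsewhere in
the chart, the differential of the inverse chart intervenes, as in `mfderiv_mfderiv_symm`. -/
theorem mfderiv_eq_fderiv_inChart {p : M} {F : M → V} (hF : MDifferentiableAt (𝓡 n) 𝓘(ℝ, V) F p)
    (v : TangentSpace (𝓡 n) p) :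
    (mfderiv (𝓡 n) 𝓘(ℝ, V) F p v : V)
      = fderiv ℝ (inChart p F) (extChartAt (𝓡 n) p p) (tangentModel p v) := by
  have h1 : fderivWithin ℝ (writtenInExtChartAt (𝓡 n) 𝓘(ℝ, V) p F) (range (𝓡 n))
      (extChartAt (𝓡 n) p p) = fderiv ℝ (inChart p F) (extChartAt (𝓡 n) p p) := by
    rw [ModelWithCorners.range_eq_univ, fderivWithin_univ]
    rfl
  have h2 := hF.mfderiv
  exact (congrArg (fun T => T v) h2).trans (congrArg (fun T => T (tangentModel p v)) h1)

theorem mfderiv_mfderiv_symm [IsManifold (𝓡 n) ∞ M] {p : M} {F : M → V}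
    {y : EuclideanSpace ℝ (Fin n)} (hy : y ∈ (extChartAt (𝓡 n) p).target)
    (hF : MDifferentiableAt (𝓡 n) 𝓘(ℝ, V) F ((extChartAt (𝓡 n) p).symm y))
    (v : EuclideanSpace ℝ (Fin n)) :
    (mfderiv (𝓡 n) 𝓘(ℝ, V) F ((extChartAt (𝓡 n) p).symm y)
      (mfderiv (𝓡 n) (𝓡 n) (extChartAt (𝓡 n) p).symm y v) : V) = fderiv ℝ (inChart p F) y v := by
  have : IsManifold (𝓡 n) 1 M := IsManifold.of_le (n := ∞) (by norm_num)
  have h1 : MDifferentiableAt 𝓘(ℝ, EuclideanSpace ℝ (Fin n)) (𝓡 n) (extChartAt (𝓡 n) p).symm y :=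
    (mdifferentiableOn_extChartAt_symm y hy).mdifferentiableAt (extChartAt_target_mem_nhds' hy)
  have h2 := mfderiv_comp y hF h1
  rw [← mfderiv_eq_fderiv]
  exact (congrArg (fun T => T v) h2).symm

/-- The differential of a real function. -/
def diffReal (a : M → ℝ) (x : M) (v : TangentSpace (𝓡 n) x) : ℝ :=
  mfderiv (𝓡 n) 𝓘(ℝ, ℝ) a x v

theorem diffReal_eq {p : M} {a : M → ℝ} (ha : MDifferentiableAt (𝓡 n) 𝓘(ℝ, ℝ) a p)
    (v : TangentSpace (𝓡 n) p) :
    diffReal a p v = fderiv ℝ (inChart p a) (extChartAt (𝓡 n) p p) (tangentModel p v) :=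
  mfderiv_eq_fderiv_inChart ha v

theorem diffReal_mfderiv_symm [IsManifold (𝓡 n) ∞ M] {p : M} {a : M → ℝ}
    {y : EuclideanSpace ℝ (Fin n)} (hy : y ∈ (extChartAt (𝓡 n) p).target)
    (ha : MDifferentiableAt (𝓡 n) 𝓘(ℝ, ℝ) a ((extChartAt (𝓡 n) p).symm y))
    (v : EuclideanSpace ℝ (Fin n)) :
    diffReal a ((extChartAt (𝓡 n) p).symm y)
      (mfderiv (𝓡 n) (𝓡 n) (extChartAt (𝓡 n) p).symm y v) = fderiv ℝ (inChart p a) y v :=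
  mfderiv_mfderiv_symm hy ha v

/-- On the target, the differential of the inverse chart undoes the differential of the chart that
defines `chartField`. -/
theorem fderiv_inChart_chartField [IsManifold (𝓡 n) ∞ M] {p : M} {F : M → V}
    (Y : ∀ x : M, TangentSpace (𝓡 n) x) {y : EuclideanSpace ℝ (Fin n)}
    (hy : y ∈ (extChartAt (𝓡 n) p).target)
    (hF : MDifferentiableAt (𝓡 n) 𝓘(ℝ, V) F ((extChartAt (𝓡 n) p).symm y)) :
    fderiv ℝ (inChart p F) y (chartField Y p y)
      = inChart p (fun x => (mfderiv (𝓡 n) 𝓘(ℝ, V) F x (Y x) : V)) y := by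
  have : IsManifold (𝓡 n) 1 M := IsManifold.of_le (n := ∞) (by norm_num)
  rw [← mfderiv_mfderiv_symm hy hF, chartField]
  have h1 := mfderivWithin_extChartAt_symm_comp_mfderiv_extChartAt (I := 𝓡 n) hy
  rw [ModelWithCorners.range_eq_univ, mfderivWithin_univ] at h1
  have h2 := congrArg (fun T => T (Y ((extChartAt (𝓡 n) p).symm y))) h1
  exact congrArg (mfderiv (𝓡 n) 𝓘(ℝ, V) F ((extChartAt (𝓡 n) p).symm y)) h2

/-- Smoothness of a tangent field is recovered from that of its image under the immersion, so it can
be read off from explicit formulas in the ambient space. -/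
theorem contDiffAt_chartField [IsManifold (𝓡 n) ∞ M] [FiniteDimensional ℝ V] {p x : M} {F : M → V}
    (Y : ∀ x : M, TangentSpace (𝓡 n) x) (hx : x ∈ (extChartAt (𝓡 n) p).source)
    (hF : ContMDiff (𝓡 n) 𝓘(ℝ, V) ∞ F)
    (hinj : ∀ x, Function.Injective (mfderiv (𝓡 n) 𝓘(ℝ, V) F x))
    (hY : ContMDiffAt (𝓡 n) 𝓘(ℝ, V) ∞ (fun x => (mfderiv (𝓡 n) 𝓘(ℝ, V) F x (Y x) : V)) x) :
    ContDiffAt ℝ ∞ (chartField Y p) (extChartAt (𝓡 n) p x) := by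
  have : IsManifold (𝓡 n) 1 M := IsManifold.of_le (n := ∞) (by norm_num)
  have hy := (extChartAt (𝓡 n) p).map_source hx
  have hFd : MDifferentiable (𝓡 n) 𝓘(ℝ, V) F := hF.mdifferentiable (by simp)
  refine contDiffAt_of_clm_apply (L := fderiv ℝ (inChart p F))
    ((contDiffAt_inChart hx hF.contMDiffAt).fderiv_right (by simp)) ?_ ?_
  -- Injectivity of `d(F ∘ chart⁻¹)`: `dF` is injective, and the differential of the chart is a left
  -- inverse of that of its inverse.
  · intro v w hvw
    rw [← mfderiv_mfderiv_symm hy (hFd _), ← mfderiv_mfderiv_symm hy (hFd _)] at hvw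
    have h2 := hinj _ hvw
    have h1 := mfderiv_extChartAt_comp_mfderivWithin_extChartAt_symm (I := 𝓡 n) hy
    rw [ModelWithCorners.range_eq_univ, mfderivWithin_univ] at h1
    have h3 := congrArg (mfderiv (𝓡 n) (𝓡 n) (extChartAt (𝓡 n) p)
      ((extChartAt (𝓡 n) p).symm (extChartAt (𝓡 n) p x))) h2
    exact (congrArg (fun T => T v) h1).symm.trans (h3.trans (congrArg (fun T => T w) h1))
  · refine (contDiffAt_inChart hx hY).congr_of_eventuallyEq ?_
    filter_upwards [extChartAt_target_mem_nhds' hy] with z hz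
    exact fderiv_inChart_chartField Y hz (hFd _)

theorem chartField_self [IsManifold (𝓡 n) ∞ M] (Y : ∀ x : M, TangentSpace (𝓡 n) x) (p : M) :
    chartField Y p (extChartAt (𝓡 n) p p) = tangentModel p (Y p) := by
  have : IsManifold (𝓡 n) 1 M := IsManifold.of_le (n := ∞) (by norm_num)
  -- The base point `chart⁻¹ (chart p)` equals `p` only propositionally and the tangent space
  -- depends on it, so it is replaced by a variable `q`.
  have key : ∀ q, q = p → (mfderiv (𝓡 n) (𝓡 n) (extChartAt (𝓡 n) p) q (Y q) :
      EuclideanSpace ℝ (Fin n)) = tangentModel p (Y p) := by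
    rintro q rfl
    rw [mfderiv_extChartAt_self]
    rfl
  exact key _ (extChartAt_to_inv p)

theorem covDeriv_eq [IsManifold (𝓡 n) ∞ M]
    (g : ∀ x : M, TangentSpace (𝓡 n) x → TangentSpace (𝓡 n) x → ℝ)
    (Y : ∀ x : M, TangentSpace (𝓡 n) x) (p : M) (v : TangentSpace (𝓡 n) p) :
    covDeriv g Y p v = (tangentModel p).symm
      (fderiv ℝ (chartField Y p) (extChartAt (𝓡 n) p p) (tangentModel p v)
        + christoffel g p (tangentModel p v) (tangentModel p (Y p))) := by
  have : IsManifold (𝓡 n) 1 M := IsManifold.of_le (n := ∞) (by norm_num)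
  have h1 : (mfderiv (𝓡 n) (𝓡 n) (extChartAt (𝓡 n) p) p v : EuclideanSpace ℝ (Fin n))
      = tangentModel p v := congrArg (fun T => T v) (mfderiv_extChartAt_self (I := 𝓡 n) (x := p))
  have h2 : ∀ d : EuclideanSpace ℝ (Fin n),
      (mfderiv (𝓡 n) (𝓡 n) (extChartAt (𝓡 n) p) p).inverse d = (tangentModel p).symm d := fun d =>
    (congrArg (fun T => T.inverse d) (mfderiv_extChartAt_self (I := 𝓡 n) (x := p))).trans
      (congrArg (fun T => T d) (ContinuousLinearMap.inverse_id (R := ℝ)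
        (M := EuclideanSpace ℝ (Fin n))))
  rw [← chartField_self, ← h1, ← h2]
  rfl

end Chart

/-! ## The induced connection -/

/-- The standing assumptions: an immersed hypersurface with unit normal field in a warped product
of an open interval and a space form. -/
structure IsWarpedHypersurface {n : ℕ} {M : Type*} [TopologicalSpace M]
    [ChartedSpace (EuclideanSpace ℝ (Fin n)) M] (I : Set ℝ) (f : ℝ → ℝ) (c : ℝ)
    (χ N : M → Amb n) : Prop extends IsHypersurface I f c χ N where
  isOpen : IsOpen I
  contDiffOn : ContDiffOn ℝ ∞ f I
  pos : ∀ t ∈ I, 0 < f t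
  curvature : c = -1 ∨ c = 0 ∨ c = 1

/-- The differential `dχ_x` as a linear map. -/
def diffLin {n : ℕ} {M : Type*} [TopologicalSpace M]
    [ChartedSpace (EuclideanSpace ℝ (Fin n)) M] (χ : M → Amb n) (x : M) :
    TangentSpace (𝓡 n) x →ₗ[ℝ] Amb n where
  toFun := diffAmb χ x
  map_add' v w := map_add (mfderiv (𝓡 n) 𝓘(ℝ, Amb n) χ x) v w
  map_smul' a v := map_smul (mfderiv (𝓡 n) 𝓘(ℝ, Amb n) χ x) a v

@[simp] theorem diffLin_apply {n : ℕ} {M : Type*} [TopologicalSpace M]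
    [ChartedSpace (EuclideanSpace ℝ (Fin n)) M] (χ : M → Amb n) (x : M)
    (v : TangentSpace (𝓡 n) x) : diffLin χ x v = diffAmb χ x v := rfl

/-- The induced metric as a bilinear form. -/
def inducedBilin {n : ℕ} {M : Type*} [TopologicalSpace M]
    [ChartedSpace (EuclideanSpace ℝ (Fin n)) M] (f : ℝ → ℝ) (c : ℝ) (χ : M → Amb n) (x : M) :
    TangentSpace (𝓡 n) x →ₗ[ℝ] TangentSpace (𝓡 n) x →ₗ[ℝ] ℝ :=
  (warpedBilin f c (χ x)).compl₁₂ (diffLin χ x) (diffLin χ x)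

theorem inducedMetric_eq {n : ℕ} {M : Type*} [TopologicalSpace M]
    [ChartedSpace (EuclideanSpace ℝ (Fin n)) M] (f : ℝ → ℝ) (c : ℝ) (χ : M → Amb n) (x : M)
    (v w : TangentSpace (𝓡 n) x) :
    inducedMetric f c χ x v w = inducedBilin f c χ x v w := rfl

theorem inducedBilin_apply {n : ℕ} {M : Type*} [TopologicalSpace M]
    [ChartedSpace (EuclideanSpace ℝ (Fin n)) M] (f : ℝ → ℝ) (c : ℝ) (χ : M → Amb n) (x : M)
    (v w : TangentSpace (𝓡 n) x) :
    inducedBilin f c χ x v w = warpedBilin f c (χ x) (diffAmb χ x v) (diffAmb χ x w) := rfl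

namespace IsWarpedHypersurface

variable {n : ℕ} {M : Type*} [TopologicalSpace M] [ChartedSpace (EuclideanSpace ℝ (Fin n)) M]
  {I : Set ℝ} {f : ℝ → ℝ} {c : ℝ} {χ N : M → Amb n}

theorem mdifferentiable (h : IsWarpedHypersurface I f c χ N) :
    MDifferentiable (𝓡 n) 𝓘(ℝ, Amb n) χ := h.smooth.mdifferentiable (by simp)

theorem differentiableAt (h : IsWarpedHypersurface I f c χ N) (x : M) :
    DifferentiableAt ℝ f (χ x).1 :=
  (h.contDiffOn.contDiffAt (h.isOpen.mem_nhds (h.mem x).1)).differentiableAt (by simp)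

theorem warp_ne_zero (h : IsWarpedHypersurface I f c χ N) (x : M) : f (χ x).1 ≠ 0 :=
  (h.pos _ (h.mem x).1).ne'

theorem diffAmb_eq (h : IsWarpedHypersurface I f c χ N) (x : M) (v : TangentSpace (𝓡 n) x) :
    diffAmb χ x v = fderiv ℝ (inChart x χ) (extChartAt (𝓡 n) x x) (tangentModel x v) :=
  mfderiv_eq_fderiv_inChart (h.mdifferentiable x) v

theorem diffAmb_symm (h : IsWarpedHypersurface I f c χ N) (p : M)
    (v : EuclideanSpace ℝ (Fin n)) :
    diffAmb χ p ((tangentModel p).symm v)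
      = fderiv ℝ (inChart p χ) (extChartAt (𝓡 n) p p) v := by
  rw [h.diffAmb_eq, LinearEquiv.apply_symm_apply]

theorem diffAmb_mem (h : IsWarpedHypersurface I f c χ N) (x : M) (v : TangentSpace (𝓡 n) x) :
    diffAmb χ x v ∈ warpedTangent c (χ x) := by
  have := fderiv_mem_warpedTangent (X := inChart x χ) (fun y => h.mem _) (extChartAt (𝓡 n) x x)
    (tangentModel x v)
  rwa [inChart_self, ← h.diffAmb_eq] at this

theorem inducedBilin_pos (h : IsWarpedHypersurface I f c χ N) (x : M)
    (v : TangentSpace (𝓡 n) x) (hv : v ≠ 0) : 0 < inducedBilin f c χ x v v := by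
  refine warpedBilin_pos h.curvature h.pos (h.mem x) (h.diffAmb_mem x v) fun h0 => hv ?_
  exact h.immersion x (h0.trans (map_zero (diffLin χ x)).symm)

/-- Nondegeneracy; it reduces identities of tangent vectors to ambient inner products. -/
theorem eq_of_inducedBilin (h : IsWarpedHypersurface I f c χ N) {x : M}
    {u v : TangentSpace (𝓡 n) x} (huv : ∀ w, inducedBilin f c χ x u w = inducedBilin f c χ x v w) :
    u = v := by
  by_contra hne
  have h1 := h.inducedBilin_pos x (u - v) (sub_ne_zero.2 hne)
  rw [map_sub (inducedBilin f c χ x), LinearMap.sub_apply, huv, sub_self] at h1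
  exact h1.false

theorem inducedBilin_tangentialPart (h : IsWarpedHypersurface I f c χ N) (x : M) (z : Amb n)
    (w : TangentSpace (𝓡 n) x) :
    inducedBilin f c χ x (tangentialPart f c χ x z) w
      = warpedBilin f c (χ x) z (diffAmb χ x w) :=
  representer_apply (inducedBilin f c χ x) (inducedMetric_eq f c χ x) (h.inducedBilin_pos x)
    ((warpedBilin f c (χ x) z).comp (diffLin χ x)) (fun _ => rfl) w

theorem riemGradient_eq (h : IsWarpedHypersurface I f c χ N) {a : M → ℝ} {x : M}
    (u : TangentSpace (𝓡 n) x)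
    (hu : ∀ w, inducedBilin f c χ x u w = diffReal a x w) :
    riemGradient (inducedMetric f c χ) a x = u :=
  representer_eq (inducedBilin f c χ x) (inducedMetric_eq f c χ x) (h.inducedBilin_pos x) u hu

variable [IsManifold (𝓡 n) ∞ M]

theorem chartMetric_eq (h : IsWarpedHypersurface I f c χ N) {p : M}
    {y : EuclideanSpace ℝ (Fin n)} (hy : y ∈ (extChartAt (𝓡 n) p).target)
    (v w : EuclideanSpace ℝ (Fin n)) :
    chartMetric (inducedMetric f c χ) p y v w
      = warpedBilin f c (inChart p χ y) (fderiv ℝ (inChart p χ) y v)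
          (fderiv ℝ (inChart p χ) y w) := by
  rw [← mfderiv_mfderiv_symm hy (h.mdifferentiable _),
    ← mfderiv_mfderiv_symm hy (h.mdifferentiable _)]
  rfl

theorem contDiffAt_chart (h : IsWarpedHypersurface I f c χ N) (p : M) :
    ContDiffAt ℝ ∞ (inChart p χ) (extChartAt (𝓡 n) p p) :=
  contDiffAt_inChart (mem_extChartAt_source p) h.smooth.contMDiffAt

/-- The Christoffel symbols of the induced metric. -/
theorem inducedBilin_christoffel (h : IsWarpedHypersurface I f c χ N) (p : M)
    (v w z : EuclideanSpace ℝ (Fin n)) :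
    inducedBilin f c χ p ((tangentModel p).symm (christoffel (inducedMetric f c χ) p v w))
        ((tangentModel p).symm z)
      = warpedBilin f c (χ p)
          (fderiv ℝ (fderiv ℝ (inChart p χ)) (extChartAt (𝓡 n) p p) v w
            + warpedGammaBilin f c (χ p) (fderiv ℝ (inChart p χ) (extChartAt (𝓡 n) p p) v)
              (fderiv ℝ (inChart p χ) (extChartAt (𝓡 n) p p) w))
          (fderiv ℝ (inChart p χ) (extChartAt (𝓡 n) p p) z) := by
  have hy := mem_extChartAt_target (I := 𝓡 n) p
  -- The two expressions for the metric coefficients agree only on the chart target, but this is a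
  -- neighbourhood, so their derivatives agree too.
  have hev : ∀ a b : EuclideanSpace ℝ (Fin n),
      (fun y => chartMetric (inducedMetric f c χ) p y a b) =ᶠ[𝓝 (extChartAt (𝓡 n) p p)]
        fun y => warpedBilin f c (inChart p χ y) (fderiv ℝ (inChart p χ) y a)
          (fderiv ℝ (inChart p χ) y b) := fun a b => by
    filter_upwards [extChartAt_target_mem_nhds p] with y hy
    exact h.chartMetric_eq hy a b
  let B := (inducedBilin f c χ p).compl₁₂ (tangentModel p).symm.toLinearMap
    (tangentModel p).symm.toLinearMap
  have hB : ∀ a b, B a b = inducedBilin f c χ p ((tangentModel p).symm a)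
    ((tangentModel p).symm b) := fun _ _ => rfl
  have hg : ∀ a b, chartMetric (inducedMetric f c χ) p (extChartAt (𝓡 n) p p) a b = B a b := by
    intro a b
    rw [h.chartMetric_eq hy, inChart_self, hB, inducedBilin_apply, h.diffAmb_symm, h.diffAmb_symm]
  have hpos : ∀ a, a ≠ 0 → 0 < B a a := fun a ha => by
    rw [hB]
    exact h.inducedBilin_pos p _ fun h0 => ha ((tangentModel p).symm.map_eq_zero_iff.1 h0)
  have hX := (h.contDiffAt_chart p).of_le (m := 2) (by norm_cast)
  have hK (z : EuclideanSpace ℝ (Fin n)) :=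
    half_fderiv_inducedMetric h.curvature (X := inChart p χ) (fun y => h.mem _)
      (y := extChartAt (𝓡 n) p p) (f := f) (by rw [inChart_self]; exact h.differentiableAt p)
      (by rw [inChart_self]; exact h.warp_ne_zero p) hX v w z
  have hR := representer_apply B hg hpos ((warpedBilin f c (inChart p χ (extChartAt (𝓡 n) p p))
      (fderiv ℝ (fderiv ℝ (inChart p χ)) (extChartAt (𝓡 n) p p) v w
        + warpedGammaBilin f c (inChart p χ (extChartAt (𝓡 n) p p))
          (fderiv ℝ (inChart p χ) (extChartAt (𝓡 n) p p) v)
          (fderiv ℝ (inChart p χ) (extChartAt (𝓡 n) p p) w))).comp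
      (fderiv ℝ (inChart p χ) (extChartAt (𝓡 n) p p)).toLinearMap) (a := fun z => (1 / 2 : ℝ) *
      (fderiv ℝ (fun y => chartMetric (inducedMetric f c χ) p y w z) (extChartAt (𝓡 n) p p) v
        + fderiv ℝ (fun y => chartMetric (inducedMetric f c χ) p y v z) (extChartAt (𝓡 n) p p) w
        - fderiv ℝ (fun y => chartMetric (inducedMetric f c χ) p y v w)
          (extChartAt (𝓡 n) p p) z)) (fun z => by
    rw [(hev w z).fderiv_eq, (hev v z).fderiv_eq, (hev v w).fderiv_eq]
    exact hK z) z
  rw [← hB, ← hg]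
  refine hR.trans ?_
  rw [(hev w z).fderiv_eq, (hev v z).fderiv_eq, (hev v w).fderiv_eq, hK z, inChart_self]

/-- The Gauss formula: the Levi-Civita connection of the induced metric is the tangential part of
the connection of the warped product. -/
theorem inducedBilin_covDeriv (h : IsWarpedHypersurface I f c χ N) (p : M)
    (Y : ∀ x : M, TangentSpace (𝓡 n) x) (v w : TangentSpace (𝓡 n) p)
    (hY : ContMDiffAt (𝓡 n) 𝓘(ℝ, Amb n) ∞ (fun x => diffAmb χ x (Y x)) p) :
    inducedBilin f c χ p (covDeriv (inducedMetric f c χ) Y p v) w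
      = warpedBilin f c (χ p)
          (covAlong f c (inChart p χ) (inChart p fun x => diffAmb χ x (Y x))
            (extChartAt (𝓡 n) p p) (tangentModel p v)) (diffAmb χ p w) := by
  have hX := h.contDiffAt_chart p
  have hd2 : DifferentiableAt ℝ (fderiv ℝ (inChart p χ)) (extChartAt (𝓡 n) p p) :=
    (hX.fderiv_right (m := 1) (by norm_cast)).differentiableAt (by norm_num)
  have hYd : DifferentiableAt ℝ (chartField Y p) (extChartAt (𝓡 n) p p) :=
    (contDiffAt_chartField Y (mem_extChartAt_source p) h.smooth h.immersion hY).differentiableAt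
      (by simp)
  -- In the chart, `dχ(Y) = DX(Y)`, with derivative `D²X(v, Y) + DX(∂_v Y)`. The last term is the
  -- flat part of `∇_v Y`; the first one, together with `warpedGamma`, is the Christoffel part.
  have hZ : (inChart p fun x => diffAmb χ x (Y x)) =ᶠ[𝓝 (extChartAt (𝓡 n) p p)]
      fun y => fderiv ℝ (inChart p χ) y (chartField Y p y) := by
    filter_upwards [extChartAt_target_mem_nhds p] with y hy
    exact (fderiv_inChart_chartField Y hy (h.mdifferentiable _)).symm
  obtain ⟨w, rfl⟩ := (tangentModel p).symm.surjective w
  rw [covDeriv_eq, map_add, map_add, LinearMap.add_apply, h.inducedBilin_christoffel, covAlong,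
    hZ.fderiv_eq, fderiv_clm_apply hd2 hYd, hZ.eq_of_nhds, chartField_self, inducedBilin_apply,
    h.diffAmb_symm, h.diffAmb_symm, ← LinearMap.add_apply, ← map_add, inChart_self]
  congr 2
  simp only [_root_.add_apply, ContinuousLinearMap.comp_apply, ContinuousLinearMap.flip_apply]
  abel

end IsWarpedHypersurface

/-! ### Regularity of solutions of an ODE and of functions read in a chart -/

/-- Bootstrapping: `g' = F ∘ g` is as regular as `g`, so each step gains one derivative. An integral
curve is only given as differentiable, while a geodesic has to be smooth. -/
theorem contDiffOn_of_hasDerivAt_comp {E : Type*} [NormedAddCommGroup E] [NormedSpace ℝ E]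
    {F : E → E} {g : ℝ → E} {J : Set ℝ} (hJ : IsOpen J)
    (hg : ∀ r ∈ J, HasDerivAt g (F (g r)) r) (hF : ∀ r ∈ J, ContDiffAt ℝ ∞ F (g r)) :
    ContDiffOn ℝ ∞ g J := by
  have hd : EqOn (deriv g) (F ∘ g) J := fun r hr => (hg r hr).deriv
  have key : ∀ k : ℕ, ContDiffOn ℝ k g J := by
    intro k
    induction k with
    | zero =>
      exact contDiffOn_zero.2 fun r hr => (hg r hr).continuousAt.continuousWithinAt
    | succ k ih =>
      rw [Nat.cast_add, Nat.cast_one, contDiffOn_succ_iff_deriv_of_isOpen hJ]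
      refine ⟨fun r hr => (hg r hr).differentiableAt.differentiableWithinAt, by simp, ?_⟩
      refine ContDiffOn.congr (fun r hr => ?_) hd
      exact ((hF r hr).of_le (by exact_mod_cast le_top)).comp_contDiffWithinAt r (ih r hr)
  exact contDiffOn_infty.2 key

theorem hasDerivAt_inv_sqrt_one_sub_sq {t : ℝ} (ht : 0 < 1 - t ^ 2) :
    HasDerivAt (fun t : ℝ => (Real.sqrt (1 - t ^ 2))⁻¹) (t * (Real.sqrt (1 - t ^ 2))⁻¹ ^ 3) t := by
  have h1 : HasDerivAt (fun t : ℝ => 1 - t ^ 2) (-(2 * t)) t := by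
    simpa using (hasDerivAt_pow 2 t).const_sub 1
  have hs : Real.sqrt (1 - t ^ 2) ≠ 0 := (Real.sqrt_pos.2 ht).ne'
  have h2 := (h1.sqrt ht.ne').fun_inv hs
  refine h2.congr_deriv ?_
  field_simp

section Chart

variable {n : ℕ} {M : Type*} [TopologicalSpace M] [ChartedSpace (EuclideanSpace ℝ (Fin n)) M]

theorem contMDiffAt_of_inChart {V : Type*} [NormedAddCommGroup V] [NormedSpace ℝ V] {p : M}
    {F : M → V} (hF : ContDiffAt ℝ ∞ (inChart p F) (extChartAt (𝓡 n) p p)) :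
    ContMDiffAt (𝓡 n) 𝓘(ℝ, V) ∞ F p := by
  have h1 := hF.comp_contMDiffAt (f := extChartAt (𝓡 n) p) contMDiffAt_extChartAt
  refine h1.congr_of_eventuallyEq ?_
  filter_upwards [extChartAt_source_mem_nhds (I := 𝓡 n) p] with x hx
  simp only [Function.comp_apply, inChart, (extChartAt (𝓡 n) p).left_inv hx]

end Chart

namespace IsWarpedHypersurface

variable {n : ℕ} {M : Type*} [TopologicalSpace M] [ChartedSpace (EuclideanSpace ℝ (Fin n)) M]
  {I : Set ℝ} {f : ℝ → ℝ} {c : ℝ} {χ N : M → Amb n}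

theorem angleFun_eq (_h : IsWarpedHypersurface I f c χ N) (x : M) :
    angleFun f c χ N x = (N x).1 := warpedBilin_vertical f c (χ x) (N x)

/-! ### The height, the angle function and the field `T` -/

/-- The dimension count writes `∂_t` as a tangent vector plus `θN`; the tangent vector has the same
products with tangent vectors as `∂_t`, so it is `T`. -/
theorem diffAmb_fieldT (h : IsWarpedHypersurface I f c χ N) (x : M) :
    diffAmb χ x (fieldT f c χ x) = (1, 0) - angleFun f c χ N x • N x := by
  obtain ⟨u, hu⟩ := exists_add_normal (E := TangentSpace (𝓡 n) x) (f := f) (ν := N x)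
    (by rw [(tangentModel x).finrank_eq, finrank_euclideanSpace_fin]) (h.mem x) (diffLin χ x)
    (h.immersion x) (h.diffAmb_mem x) (h.normal_tangent x) (h.normal_unit x)
    (h.normal_orthogonal x) (z := (1, 0)) (by simp [mem_warpedTangent, IsTangentSpaceForm])
  have hTu : fieldT f c χ x = u := by
    refine h.eq_of_inducedBilin fun w => ?_
    rw [fieldT, h.inducedBilin_tangentialPart, hu, map_add, LinearMap.add_apply, map_smul,
      LinearMap.smul_apply, warpedBilin_apply, warpedBilin_apply f c _ (N x), h.normal_orthogonal]
    simp [inducedBilin_apply]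
  rw [hTu]
  exact eq_sub_of_add_eq hu.symm

/-- Together with `mfderiv_height` this makes `T` the gradient of the height; below, `(diffAmb χ x
w).1` plays the role of `dπ(w)`. -/
theorem inducedBilin_fieldT (h : IsWarpedHypersurface I f c χ N) (x : M)
    (w : TangentSpace (𝓡 n) x) :
    inducedBilin f c χ x (fieldT f c χ x) w = (diffAmb χ x w).1 := by
  rw [fieldT, h.inducedBilin_tangentialPart, warpedBilin_vertical]

theorem normSqT_eq (h : IsWarpedHypersurface I f c χ N) (x : M) :
    normSqT f c χ x = 1 - angleFun f c χ N x ^ 2 := by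
  rw [normSqT, inducedMetric_eq, h.inducedBilin_fieldT, h.diffAmb_fieldT, Prod.fst_sub,
    Prod.smul_fst, ← h.angleFun_eq, smul_eq_mul, sq]

theorem mdifferentiable_height (h : IsWarpedHypersurface I f c χ N) :
    MDifferentiable (𝓡 n) 𝓘(ℝ, ℝ) (heightFun χ) :=
  ((ContinuousLinearMap.fst ℝ ℝ _).contDiff.comp_contMDiff h.smooth).mdifferentiable (by simp)

theorem contMDiff_height (h : IsWarpedHypersurface I f c χ N) :
    ContMDiff (𝓡 n) 𝓘(ℝ, ℝ) ∞ (heightFun χ) :=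
  (ContinuousLinearMap.fst ℝ ℝ _).contDiff.comp_contMDiff h.smooth

theorem contMDiff_angle (h : IsWarpedHypersurface I f c χ N) :
    ContMDiff (𝓡 n) 𝓘(ℝ, ℝ) ∞ (angleFun f c χ N) := by
  rw [show angleFun f c χ N = fun x => (N x).1 from funext h.angleFun_eq]
  exact (ContinuousLinearMap.fst ℝ ℝ _).contDiff.comp_contMDiff h.normal_smooth

theorem ambCovDeriv_eq (h : IsWarpedHypersurface I f c χ N) (p : M) (v : TangentSpace (𝓡 n) p) :
    ambCovDeriv f c χ N p v
      = covAlong f c (inChart p χ) (inChart p N) (extChartAt (𝓡 n) p p) (tangentModel p v) := by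
  rw [covAlong, inChart_self, inChart_self, ambCovDeriv, h.diffAmb_eq, diffAmb,
    mfderiv_eq_fderiv_inChart ((h.normal_smooth.mdifferentiable (by simp)) p)]
  rfl

theorem inducedBilin_shapeOperator (h : IsWarpedHypersurface I f c χ N) (p : M)
    (v w : TangentSpace (𝓡 n) p) :
    inducedBilin f c χ p (shapeOperator f c χ N p v) w
      = -warpedBilin f c (χ p) (covAlong f c (inChart p χ) (inChart p N) (extChartAt (𝓡 n) p p)
          (tangentModel p v)) (diffAmb χ p w) := by
  rw [shapeOperator, h.inducedBilin_tangentialPart, h.ambCovDeriv_eq, map_neg, LinearMap.neg_apply]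

theorem shapeOperator_smul (h : IsWarpedHypersurface I f c χ N) (p : M) (a : ℝ)
    (v : TangentSpace (𝓡 n) p) :
    shapeOperator f c χ N p (a • v) = a • shapeOperator f c χ N p v := by
  refine h.eq_of_inducedBilin fun w => ?_
  rw [h.inducedBilin_shapeOperator, map_smul, map_smul (inducedBilin f c χ p), LinearMap.smul_apply,
    h.inducedBilin_shapeOperator, covAlong, covAlong, map_smul, map_smul, map_smul,
    LinearMap.smul_apply, ← smul_add, map_smul, LinearMap.smul_apply, smul_neg]

variable [IsManifold (𝓡 n) ∞ M]

theorem fderiv_height (h : IsWarpedHypersurface I f c χ N) (p : M)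
    (v : EuclideanSpace ℝ (Fin n)) :
    fderiv ℝ (inChart p (heightFun χ)) (extChartAt (𝓡 n) p p) v
      = (fderiv ℝ (inChart p χ) (extChartAt (𝓡 n) p p) v).1 := by
  have hd := (h.contDiffAt_chart p).differentiableAt (by simp)
  have := ((ContinuousLinearMap.fst ℝ ℝ (EuclideanSpace ℝ (Fin (n + 1)))).hasFDerivAt.comp _
    hd.hasFDerivAt).fderiv
  exact congrArg (fun T => T v) this

theorem mfderiv_height (h : IsWarpedHypersurface I f c χ N) (p : M) (v : TangentSpace (𝓡 n) p) :
    diffReal (heightFun χ) p v = (diffAmb χ p v).1 := by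
  rw [diffReal_eq (h.mdifferentiable_height p), h.fderiv_height, h.diffAmb_eq]

theorem contDiffAt_normal (h : IsWarpedHypersurface I f c χ N) (p : M) :
    ContDiffAt ℝ ∞ (inChart p N) (extChartAt (𝓡 n) p p) :=
  contDiffAt_inChart (mem_extChartAt_source p) h.normal_smooth.contMDiffAt

theorem inducedBilin_shapeOperator_symm (h : IsWarpedHypersurface I f c χ N) (p : M)
    (v w : TangentSpace (𝓡 n) p) :
    inducedBilin f c χ p (shapeOperator f c χ N p v) w
      = inducedBilin f c χ p (shapeOperator f c χ N p w) v := by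
  rw [h.inducedBilin_shapeOperator, h.inducedBilin_shapeOperator]
  have horth : ∀ w, ∀ᶠ y in 𝓝 (extChartAt (𝓡 n) p p),
      warpedBilin f c (inChart p χ y) (inChart p N y) (fderiv ℝ (inChart p χ) y w) = 0 := by
    intro w
    filter_upwards [extChartAt_target_mem_nhds p] with y hy
    rw [← mfderiv_mfderiv_symm hy (h.mdifferentiable _)]
    exact h.normal_orthogonal _ _
  have := warpedBilin_covAlong_normal_symm h.curvature (X := inChart p χ) (ν := inChart p N)
    (f := f) (fun y => h.mem _) (y := extChartAt (𝓡 n) p p)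
    (by rw [inChart_self]; exact h.differentiableAt p)
    (by rw [inChart_self]; exact h.warp_ne_zero p)
    ((h.contDiffAt_chart p).of_le (by norm_cast))
    ((h.contDiffAt_normal p).differentiableAt (by simp))
    (h.normal_tangent _) horth (tangentModel p v) (tangentModel p w)
  rw [inChart_self, ← h.diffAmb_eq, ← h.diffAmb_eq] at this
  rw [this]

/-- `dθ(w) = -⟨A T, w⟩ - (f' / f) θ ⟨T, w⟩`. -/
theorem mfderiv_angle (h : IsWarpedHypersurface I f c χ N) (p : M) (w : TangentSpace (𝓡 n) p) :
    diffReal (angleFun f c χ N) p w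
      = -inducedBilin f c χ p (shapeOperator f c χ N p (fieldT f c χ p)) w
        - deriv f (heightFun χ p) / f (heightFun χ p) * angleFun f c χ N p * (diffAmb χ p w).1 := by
  have hf : DifferentiableAt ℝ f (inChart p χ (extChartAt (𝓡 n) p p)).1 := by
    rw [inChart_self]; exact h.differentiableAt p
  have hf0 : f (inChart p χ (extChartAt (𝓡 n) p p)).1 ≠ 0 := by
    rw [inChart_self]; exact h.warp_ne_zero p
  have hX := (h.contDiffAt_chart p).differentiableAt (by simp)
  have hν := (h.contDiffAt_normal p).differentiableAt (by simp)
  have hνt : inChart p N (extChartAt (𝓡 n) p p)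
    ∈ warpedTangent c (inChart p χ (extChartAt (𝓡 n) p p)) := h.normal_tangent _
  -- Differentiating `⟨N, N⟩ = 1` shows that `∇_w N` is orthogonal to `N`, so pairing it with `T =
  -- ∂_t - θN` is the same as pairing it with `∂_t`.
  have h1 := fderiv_warpedBilin h.curvature hf hf0 hX hν hν hνt hνt (tangentModel p w)
  rw [show (fun y => warpedBilin f c (inChart p χ y) (inChart p N y) (inChart p N y))
    = fun _ => 1 from funext fun y => h.normal_unit _, fderiv_fun_const] at h1
  -- The derivative of `θ = ⟨∂_t, N⟩`: `∇_w ∂_t` yields the term with `f'/f`, and `⟨∂_t, ∇_w N⟩ =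
  -- -⟨A w, T⟩`.
  have h2 := fderiv_warpedBilin h.curvature hf hf0 hX
    (differentiableAt_const ((1, 0) : Amb n)) hν
    (by simp [mem_warpedTangent, IsTangentSpaceForm]) hνt (tangentModel p w)
  rw [diffReal_eq ((h.contMDiff_angle.mdifferentiable (by simp)) p),
    h.inducedBilin_shapeOperator_symm, h.inducedBilin_shapeOperator, h.diffAmb_fieldT]
  refine h2.trans ?_
  rw [covAlong_vertical, inChart_self, inChart_self, ← h.diffAmb_eq]
  simp only [inChart_self, Pi.zero_apply, _root_.zero_apply] at h1
  set C := covAlong f c (inChart p χ) (inChart p N) (extChartAt (𝓡 n) p p) (tangentModel p w)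
  have h3 : warpedBilin f c (χ p) C (N p) = 0 := by
    rw [warpedBilin_comm f c (χ p) (N p)] at h1
    linarith
  have h4 : warpedBilin f c (χ p) (diffAmb χ p w) (N p) = 0 := by
    rw [warpedBilin_comm]
    exact h.normal_orthogonal p w
  have h5 : warpedBilin f c (χ p) (1, 0) (N p) = angleFun f c χ N p := rfl
  have h6 : warpedBilin f c (χ p) C (1, 0) = warpedBilin f c (χ p) (1, 0) C :=
    warpedBilin_comm f c _ _ _
  simp only [map_smul, map_sub, LinearMap.smul_apply, LinearMap.sub_apply, h3, h4, h5, h6,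
    smul_eq_mul, heightFun]
  ring

end IsWarpedHypersurface

/-! ### The unit field `T / |T|` -/

namespace IsWarpedHypersurface

variable {n : ℕ} {M : Type*} [TopologicalSpace M] [ChartedSpace (EuclideanSpace ℝ (Fin n)) M]
  {I : Set ℝ} {f : ℝ → ℝ} {c : ℝ} {χ N : M → Amb n}

theorem contDiffAt_deriv_div (h : IsWarpedHypersurface I f c χ N) (x : M) :
    ContDiffAt ℝ ∞ (fun t => deriv f t / f t) (heightFun χ x) := by
  have hx : heightFun χ x ∈ I := (h.mem x).1
  have h1 := h.contDiffOn.contDiffAt (h.isOpen.mem_nhds hx)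
  have h2 : ContDiffAt ℝ ∞ (deriv f) (heightFun χ x) :=
    (((contDiffOn_infty_iff_deriv_of_isOpen h.isOpen).1 h.contDiffOn).2).contDiffAt
      (h.isOpen.mem_nhds hx)
  exact h2.div h1 (h.pos _ hx).ne'

theorem unitT_eq (h : IsWarpedHypersurface I f c χ N) (x : M) :
    unitT f c χ x = (Real.sqrt (1 - angleFun f c χ N x ^ 2))⁻¹ • fieldT f c χ x := by
  rw [unitT, h.normSqT_eq]

theorem diffAmb_unitT (h : IsWarpedHypersurface I f c χ N) (x : M) :
    diffAmb χ x (unitT f c χ x) = (Real.sqrt (1 - angleFun f c χ N x ^ 2))⁻¹ •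
      ((1, 0) - angleFun f c χ N x • N x) := by
  rw [h.unitT_eq, ← h.diffAmb_fieldT]
  exact map_smul (diffLin χ x) _ _

/-- The quantity is `|T|²`; its positivity justifies the square roots and divisions below. -/
theorem angle_pos (h : IsWarpedHypersurface I f c χ N) {x : M} (hT : fieldT f c χ x ≠ 0) :
    0 < 1 - angleFun f c χ N x ^ 2 := by
  rw [← h.normSqT_eq, normSqT, inducedMetric_eq]
  exact h.inducedBilin_pos x _ hT

theorem inducedBilin_unitT_self (h : IsWarpedHypersurface I f c χ N) {x : M}
    (hT : fieldT f c χ x ≠ 0) : inducedBilin f c χ x (unitT f c χ x) (unitT f c χ x) = 1 := by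
  have h0 := h.angle_pos hT
  have h1 := Real.sq_sqrt h0.le
  have h2 : inducedBilin f c χ x (fieldT f c χ x) (fieldT f c χ x)
      = 1 - angleFun f c χ N x ^ 2 := by
    rw [← h.normSqT_eq, normSqT, inducedMetric_eq]
  have h3 := Real.sqrt_pos.2 h0
  rw [h.unitT_eq, map_smul, map_smul, LinearMap.smul_apply, h2, smul_eq_mul, smul_eq_mul]
  field_simp
  linarith

theorem contMDiffAt_diffAmb_unitT (h : IsWarpedHypersurface I f c χ N) {x : M}
    (hT : fieldT f c χ x ≠ 0) :
    ContMDiffAt (𝓡 n) 𝓘(ℝ, Amb n) ∞ (fun x => diffAmb χ x (unitT f c χ x)) x := by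
  rw [show (fun x => diffAmb χ x (unitT f c χ x)) = _ from funext h.diffAmb_unitT]
  have h0 := h.angle_pos hT
  have hr : ContDiffAt ℝ ∞ (fun t : ℝ => (Real.sqrt (1 - t ^ 2))⁻¹) (angleFun f c χ N x) :=
    ((contDiffAt_const.sub (contDiffAt_id.pow 2)).sqrt h0.ne').inv (Real.sqrt_pos.2 h0).ne'
  have hθ := h.contMDiff_angle.contMDiffAt (x := x)
  exact (hr.comp_contMDiffAt hθ).smul
    (contMDiffAt_const.sub (hθ.smul h.normal_smooth.contMDiffAt))

variable [IsManifold (𝓡 n) ∞ M]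

/-- The unit field `T / |T|` is geodesic wherever `T` is an eigenvector of the shape operator. -/
theorem covDeriv_unitT (h : IsWarpedHypersurface I f c χ N) {p : M} {l : ℝ}
    (hT : fieldT f c χ p ≠ 0)
    (hA : shapeOperator f c χ N p (fieldT f c χ p) = l • fieldT f c χ p) :
    covDeriv (inducedMetric f c χ) (unitT f c χ) p (unitT f c χ p) = 0 := by
  refine h.eq_of_inducedBilin fun w => ?_
  rw [map_zero, LinearMap.zero_apply,
    h.inducedBilin_covDeriv p _ _ _ (h.contMDiffAt_diffAmb_unitT hT)]
  have h0 := h.angle_pos hT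
  set θ := angleFun f c χ N p with hθ
  set ρ := (Real.sqrt (1 - θ ^ 2))⁻¹ with hρ
  have hρ2 : ρ ^ 2 * (1 - θ ^ 2) = 1 := by
    rw [hρ, inv_pow, Real.sq_sqrt h0.le, inv_mul_cancel₀ h0.ne']
  set y := extChartAt (𝓡 n) p p
  have hθd : DifferentiableAt ℝ (inChart p (angleFun f c χ N)) y :=
    (contDiffAt_inChart (mem_extChartAt_source p) h.contMDiff_angle.contMDiffAt).differentiableAt
      (by simp)
  have hνd : DifferentiableAt ℝ (inChart p N) y :=
    (h.contDiffAt_normal p).differentiableAt (by simp)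
  have hrd : HasDerivAt (fun t : ℝ => (Real.sqrt (1 - t ^ 2))⁻¹) (θ * ρ ^ 3)
      (inChart p (angleFun f c χ N) y) := by
    rw [inChart_self]
    exact hasDerivAt_inv_sqrt_one_sub_sq h0
  have hrθ := hrd.comp_hasFDerivAt y hθd.hasFDerivAt
  -- The ambient expression `ρ (∂_t - θN)` of the unit field is differentiated factor by factor.
  have hZ : (inChart p fun x => diffAmb χ x (unitT f c χ x))
      = fun y : EuclideanSpace ℝ (Fin n) =>
        ((fun t : ℝ => (Real.sqrt (1 - t ^ 2))⁻¹) ∘ inChart p (angleFun f c χ N)) y •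
          ((1, 0) - inChart p (angleFun f c χ N) y • inChart p N y) :=
    funext fun y => h.diffAmb_unitT _
  have hsm := hθd.fun_smul hνd
  rw [hZ, covAlong_smul f c hrθ.differentiableAt ((differentiableAt_const _).fun_sub hsm),
    covAlong_sub f c (differentiableAt_const _) hsm, covAlong_smul f c hθd hνd, covAlong_vertical,
    hrθ.fderiv]
  simp only [Function.comp_apply, y, inChart_self, ← h.diffAmb_eq, _root_.smul_apply, ← hθ]
  rw [← diffReal_eq ((h.contMDiff_angle.mdifferentiable (by simp)) p),
    h.mfderiv_angle, hA]
  have e1 : warpedBilin f c (χ p) (1, 0) (diffAmb χ p w) = (diffAmb χ p w).1 :=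
    warpedBilin_vertical f c _ _
  have e2 : warpedBilin f c (χ p) (N p) (diffAmb χ p w) = 0 := h.normal_orthogonal p w
  have e3 : warpedBilin f c (χ p) (diffAmb χ p (unitT f c χ p)) (diffAmb χ p w)
      = ρ * (diffAmb χ p w).1 := by
    rw [h.diffAmb_unitT, map_smul, LinearMap.smul_apply, map_sub, LinearMap.sub_apply, map_smul,
      LinearMap.smul_apply, e1, e2, smul_zero, sub_zero, smul_eq_mul]
  have e4 : warpedBilin f c (χ p) (covAlong f c (inChart p χ) (inChart p N) (extChartAt (𝓡 n) p p)
      (tangentModel p (unitT f c χ p))) (diffAmb χ p w) = -(ρ * (l * (diffAmb χ p w).1)) := by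
    have := h.inducedBilin_shapeOperator p (unitT f c χ p) w
    rw [h.unitT_eq, h.shapeOperator_smul, hA, map_smul, LinearMap.smul_apply, map_smul,
      LinearMap.smul_apply, h.inducedBilin_fieldT, smul_eq_mul, smul_eq_mul, ← h.unitT_eq] at this
    linarith
  have e5 : (diffAmb χ p (unitT f c χ p)).1 = ρ * (1 - θ ^ 2) := by
    rw [h.diffAmb_unitT, Prod.smul_fst, Prod.fst_sub, Prod.smul_fst, ← h.angleFun_eq, smul_eq_mul,
      smul_eq_mul, ← sq]
  have e6 : inducedBilin f c χ p (fieldT f c χ p) (unitT f c χ p) = ρ * (1 - θ ^ 2) := by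
    rw [h.inducedBilin_fieldT, e5]
  have e7 : (deriv f (χ p).1 / f (χ p).1) = deriv f (heightFun χ p) / f (heightFun χ p) := rfl
  simp only [map_add, map_sub, map_smul, LinearMap.add_apply, LinearMap.sub_apply,
    LinearMap.smul_apply, e1, e2, e3, e4, e5, e6, e7, smul_eq_mul]
  generalize deriv f (heightFun χ p) / f (heightFun χ p) = k
  generalize (diffAmb χ p w).1 = a
  -- The derivative of `ρ` contributes `-θρ²(l + kθ)a` once `ρ²(1 - θ²) = 1` is used; `∇∂_t`
  -- contributes `kθ²ρ²a` and `-θ∇N` contributes `lθρ²a`, which cancel it.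
  linear_combination (-(a * θ * ρ ^ 2 * l) - a * θ ^ 2 * k * ρ ^ 2) * hρ2

end IsWarpedHypersurface

theorem covAlong_congr {n : ℕ} {E : Type*} [NormedAddCommGroup E] [NormedSpace ℝ E] (f : ℝ → ℝ)
    (c : ℝ) (X : E → Amb n) {Z W : E → Amb n} {y : E} (hZW : Z =ᶠ[𝓝 y] W) (v : E) :
    covAlong f c X Z y v = covAlong f c X W y v := by
  rw [covAlong, covAlong, hZW.fderiv_eq, hZW.eq_of_nhds]

theorem IsPreconnected.eq_of_locally_eq {α β : Type*} [TopologicalSpace α] {S : Set α}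
    (hS : IsPreconnected S) {F : α → β} (hF : ∀ x ∈ S, ∃ W ∈ 𝓝 x, ∀ a ∈ W ∩ S, F a = F x)
    {x y : α} (hx : x ∈ S) (hy : y ∈ S) : F x = F y := by
  have := isPreconnected_iff_preconnectedSpace.1 hS
  have hloc : IsLocallyConstant fun z : S => F z := by
    rw [IsLocallyConstant.iff_eventually_eq]
    intro z
    obtain ⟨W, hW, hWF⟩ := hF z z.2
    filter_upwards [continuous_subtype_val.continuousAt.preimage_mem_nhds hW] with a ha
    exact hWF a ⟨ha, a.2⟩
  exact hloc.apply_eq_of_preconnectedSpace ⟨x, hx⟩ ⟨y, hy⟩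

namespace IsWarpedHypersurface

variable {n : ℕ} {M : Type*} [TopologicalSpace M] [ChartedSpace (EuclideanSpace ℝ (Fin n)) M]
  {I : Set ℝ} {f : ℝ → ℝ} {c : ℝ} {χ N : M → Amb n} [IsManifold (𝓡 n) ∞ M]
  {U : Set M} {lam : M → ℝ}

/-! ### Principal direction `T` -/

theorem mfderiv_angle_of_eigen (h : IsWarpedHypersurface I f c χ N) {p : M} {l : ℝ}
    (hA : shapeOperator f c χ N p (fieldT f c χ p) = l • fieldT f c χ p)
    (w : TangentSpace (𝓡 n) p) :
    diffReal (angleFun f c χ N) p w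
      = -((l + deriv f (heightFun χ p) / f (heightFun χ p) * angleFun f c χ N p)
          * (diffAmb χ p w).1) := by
  rw [h.mfderiv_angle, hA, map_smul, LinearMap.smul_apply, h.inducedBilin_fieldT, smul_eq_mul]
  ring

/-- `∇θ = -(λ + (f' / f) θ) T`. -/
theorem riemGradient_angle (h : IsWarpedHypersurface I f c χ N) {p : M} {l : ℝ}
    (hA : shapeOperator f c χ N p (fieldT f c χ p) = l • fieldT f c χ p) :
    riemGradient (inducedMetric f c χ) (angleFun f c χ N) p
      = -((l + deriv f (heightFun χ p) / f (heightFun χ p) * angleFun f c χ N p)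
          • fieldT f c χ p) := by
  refine h.riemGradient_eq _ fun w => ?_
  rw [h.mfderiv_angle_of_eigen hA, map_neg, LinearMap.neg_apply, map_smul, LinearMap.smul_apply,
    h.inducedBilin_fieldT, smul_eq_mul]

/-- `dθ = -(λ + (f' / f) θ) dπ` in a chart. -/
theorem eventually_fderiv_angle (h : IsWarpedHypersurface I f c χ N) (hU : IsOpen U)
    (hA : ∀ x ∈ U, shapeOperator f c χ N x (fieldT f c χ x) = lam x • fieldT f c χ x) {p : M}
    (hp : p ∈ U) :
    ∀ᶠ y in 𝓝 (extChartAt (𝓡 n) p p), fderiv ℝ (inChart p (angleFun f c χ N)) y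
      = -((inChart p lam y + deriv f (inChart p (heightFun χ) y) / f (inChart p (heightFun χ) y)
          * inChart p (angleFun f c χ N) y) • fderiv ℝ (inChart p (heightFun χ)) y) := by
  filter_upwards [inChart_eventually (mem_extChartAt_source p) (hU.mem_nhds hp)] with y hy
  ext v
  rw [← diffReal_mfderiv_symm hy.1 (h.contMDiff_angle.mdifferentiable (by simp) _),
    h.mfderiv_angle_of_eigen (hA _ hy.2), ← h.mfderiv_height,
    diffReal_mfderiv_symm hy.1 (h.mdifferentiable_height _)]
  rfl

/-- `dπ(T) = |T|²`: where `T` does not vanish, `π` is a submersion, and `T` is a direction that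
detects it. -/
theorem fderiv_height_fieldT (h : IsWarpedHypersurface I f c χ N) {p : M} :
    fderiv ℝ (inChart p (heightFun χ)) (extChartAt (𝓡 n) p p) (tangentModel p (fieldT f c χ p))
      = 1 - angleFun f c χ N p ^ 2 := by
  rw [h.fderiv_height, ← h.diffAmb_eq, ← h.inducedBilin_fieldT, ← h.normSqT_eq, normSqT,
    inducedMetric_eq]

theorem contDiffAt_height (h : IsWarpedHypersurface I f c χ N) (p : M) :
    ContDiffAt ℝ ∞ (inChart p (heightFun χ)) (extChartAt (𝓡 n) p p) :=
  contDiffAt_inChart (mem_extChartAt_source p) h.contMDiff_height.contMDiffAt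

theorem contDiffAt_angle (h : IsWarpedHypersurface I f c χ N) (p : M) :
    ContDiffAt ℝ ∞ (inChart p (angleFun f c χ N)) (extChartAt (𝓡 n) p p) :=
  contDiffAt_inChart (mem_extChartAt_source p) h.contMDiff_angle.contMDiffAt

theorem contDiffAt_warp (h : IsWarpedHypersurface I f c χ N) (p : M) :
    ContDiffAt ℝ ∞ (fun y => deriv f (inChart p (heightFun χ) y) / f (inChart p (heightFun χ) y))
      (extChartAt (𝓡 n) p p) := by
  have h1 : ContDiffAt ℝ ∞ (fun t => deriv f t / f t)
      (inChart p (heightFun χ) (extChartAt (𝓡 n) p p)) := by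
    rw [inChart_self]
    exact h.contDiffAt_deriv_div p
  exact h1.comp _ (h.contDiffAt_height p)

/-- Solve `dθ = -(λ + (f'/f)θ) dπ` for `λ` by evaluating it on a vector `v` with `dπ(v) ≠ 0`. Here
`v` is `T` at `p`, kept constant in the chart, so it works on a neighbourhood. -/
theorem contDiffAt_eigenvalue (h : IsWarpedHypersurface I f c χ N) (hU : IsOpen U)
    (hT : ∀ x ∈ U, fieldT f c χ x ≠ 0)
    (hA : ∀ x ∈ U, shapeOperator f c χ N x (fieldT f c χ x) = lam x • fieldT f c χ x) {p : M}
    (hp : p ∈ U) : ContDiffAt ℝ ∞ (inChart p lam) (extChartAt (𝓡 n) p p) := by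
  set y := extChartAt (𝓡 n) p p
  set v := tangentModel p (fieldT f c χ p)
  have hπ := (h.contDiffAt_height p).fderiv_right (m := ∞) (by simp)
  have hθ := (h.contDiffAt_angle p).fderiv_right (m := ∞) (by simp)
  have hπv : ContDiffAt ℝ ∞ (fun z => fderiv ℝ (inChart p (heightFun χ)) z v) y :=
    hπ.clm_apply contDiffAt_const
  have hθv : ContDiffAt ℝ ∞ (fun z => fderiv ℝ (inChart p (angleFun f c χ N)) z v) y :=
    hθ.clm_apply contDiffAt_const
  have hne : fderiv ℝ (inChart p (heightFun χ)) y v ≠ 0 := by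
    rw [h.fderiv_height_fieldT (N := N)]
    exact (h.angle_pos (hT p hp)).ne'
  refine ((hθv.div hπv hne).neg.sub
    ((h.contDiffAt_warp p).mul (h.contDiffAt_angle p))).congr_of_eventuallyEq ?_
  filter_upwards [h.eventually_fderiv_angle hU hA hp, hπv.continuousAt.eventually_ne hne]
    with z hz hz0
  have hz' := congrArg (fun T => T v) hz
  simp only [_root_.neg_apply, _root_.smul_apply, smul_eq_mul] at hz'
  simp only [Pi.div_apply, hz']
  field_simp
  ring

theorem contMDiffOn_eigenvalue (h : IsWarpedHypersurface I f c χ N) (hU : IsOpen U)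
    (hT : ∀ x ∈ U, fieldT f c χ x ≠ 0)
    (hA : ∀ x ∈ U, shapeOperator f c χ N x (fieldT f c χ x) = lam x • fieldT f c χ x) :
    ContMDiffOn (𝓡 n) 𝓘(ℝ, ℝ) ∞ lam U := fun _ hp =>
  (contMDiffAt_of_inChart (h.contDiffAt_eigenvalue hU hT hA hp)).contMDiffWithinAt

/-- `dλ ∧ dπ = 0`. -/
theorem fderiv_eigenvalue_wedge (h : IsWarpedHypersurface I f c χ N) (hU : IsOpen U)
    (hT : ∀ x ∈ U, fieldT f c χ x ≠ 0)
    (hA : ∀ x ∈ U, shapeOperator f c χ N x (fieldT f c χ x) = lam x • fieldT f c χ x) {p : M}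
    (hp : p ∈ U) (v w : EuclideanSpace ℝ (Fin n)) :
    fderiv ℝ (inChart p lam) (extChartAt (𝓡 n) p p) v
        * fderiv ℝ (inChart p (heightFun χ)) (extChartAt (𝓡 n) p p) w
      = fderiv ℝ (inChart p lam) (extChartAt (𝓡 n) p p) w
        * fderiv ℝ (inChart p (heightFun χ)) (extChartAt (𝓡 n) p p) v := by
  have hl := (h.contDiffAt_eigenvalue hU hT hA hp).differentiableAt (by simp)
  have hθ := (h.contDiffAt_angle p).differentiableAt (by simp)
  have hπ := (h.contDiffAt_height p).differentiableAt (by simp)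
  have h1 : DifferentiableAt ℝ (fun t => deriv f t / f t)
      (inChart p (heightFun χ) (extChartAt (𝓡 n) p p)) := by
    rw [inChart_self]
    exact (h.contDiffAt_deriv_div p).differentiableAt (by simp)
  have hk := h1.hasDerivAt.comp_hasFDerivAt _ hπ.hasFDerivAt
  have hev := h.eventually_fderiv_angle hU hA hp
  have hh := hl.hasFDerivAt.fun_add (hk.fun_mul hθ.hasFDerivAt)
  have := fderiv_mul_fderiv_symm ((h.contDiffAt_angle p).of_le (by norm_cast))
    ((h.contDiffAt_height p).of_le (by norm_cast)) hh.differentiableAt hev v w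
  -- In `d(λ + kθ) ∧ dπ = 0` with `k = f'/f`, the parts from `dk` and `dθ` drop out, since both are
  -- multiples of `dπ`.
  rw [hh.fderiv, hev.self_of_nhds] at this
  simp only [_root_.neg_apply, _root_.add_apply, _root_.smul_apply, smul_eq_mul] at this
  linear_combination this

/-- Evaluating `dλ ∧ dπ = 0` on `w` and `T` gives `|T|² dλ(w) = dλ(T) ⟨T, w⟩`; divide by `|T|²`. -/
theorem mfderiv_eigenvalue (h : IsWarpedHypersurface I f c χ N) (hU : IsOpen U)
    (hT : ∀ x ∈ U, fieldT f c χ x ≠ 0)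
    (hA : ∀ x ∈ U, shapeOperator f c χ N x (fieldT f c χ x) = lam x • fieldT f c χ x) {p : M}
    (hp : p ∈ U) (w : TangentSpace (𝓡 n) p) :
    diffReal lam p w
      = diffReal lam p (unitT f c χ p)
        * inducedBilin f c χ p (unitT f c χ p) w := by
  have hd : MDifferentiableAt (𝓡 n) 𝓘(ℝ, ℝ) lam p :=
    (contMDiffAt_of_inChart (h.contDiffAt_eigenvalue hU hT hA hp)).mdifferentiableAt (by simp)
  have h0 := h.angle_pos (hT p hp)
  have hs := Real.sq_sqrt h0.le
  have hsp := Real.sqrt_pos.2 h0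
  have h1 := h.fderiv_eigenvalue_wedge hU hT hA hp (tangentModel p w)
    (tangentModel p (fieldT f c χ p))
  rw [h.fderiv_height_fieldT (N := N), h.fderiv_height, ← h.diffAmb_eq] at h1
  rw [diffReal_eq hd, diffReal_eq hd, h.unitT_eq, map_smul, map_smul,
    map_smul, LinearMap.smul_apply, h.inducedBilin_fieldT, smul_eq_mul, smul_eq_mul]
  generalize Real.sqrt (1 - angleFun f c χ N p ^ 2) = s at *
  rw [← hs] at h1
  field_simp
  linear_combination h1

/-- With `E = T/|T|` and `∇_E E = 0`, only `∇_E(λE) = dλ(E) E` survives. -/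
theorem covDerivTensor_unitT (h : IsWarpedHypersurface I f c χ N) (hU : IsOpen U)
    (hT : ∀ x ∈ U, fieldT f c χ x ≠ 0)
    (hA : ∀ x ∈ U, shapeOperator f c χ N x (fieldT f c χ x) = lam x • fieldT f c χ x) {p : M}
    (hp : p ∈ U) :
    covDerivTensor (inducedMetric f c χ) (shapeOperator f c χ N) (unitT f c χ) p (unitT f c χ p)
      = diffReal lam p (unitT f c χ p) • unitT f c χ p := by
  have hcov := h.covDeriv_unitT (hT p hp) (hA p hp)
  have h00 : shapeOperator f c χ N p 0 = 0 := by
    have := h.shapeOperator_smul p 0 0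
    rwa [zero_smul, zero_smul] at this
  have hlc := contMDiffAt_of_inChart (h.contDiffAt_eigenvalue hU hT hA hp)
  have hu := h.contMDiffAt_diffAmb_unitT (hT p hp)
  have hEq : ∀ x ∈ U, diffAmb χ x (shapeOperator f c χ N x (unitT f c χ x))
      = lam x • diffAmb χ x (unitT f c χ x) := by
    intro x hx
    have : shapeOperator f c χ N x (unitT f c χ x) = lam x • unitT f c χ x := by
      rw [h.unitT_eq, h.shapeOperator_smul, hA x hx, smul_comm]
    rw [this]
    exact map_smul (diffLin χ x) _ _
  have hsm : ContMDiffAt (𝓡 n) 𝓘(ℝ, Amb n) ∞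
      (fun x => diffAmb χ x (shapeOperator f c χ N x (unitT f c χ x))) p := by
    refine (hlc.smul hu).congr_of_eventuallyEq ?_
    filter_upwards [hU.mem_nhds hp] with x hx
    exact hEq x hx
  -- `AE = λE` is known only on `U`; since `U` is open, this determines the derivative at `p`.
  have hch : (inChart p fun x => diffAmb χ x (shapeOperator f c χ N x (unitT f c χ x)))
      =ᶠ[𝓝 (extChartAt (𝓡 n) p p)]
        fun y => inChart p lam y • inChart p (fun x => diffAmb χ x (unitT f c χ x)) y := by
    filter_upwards [inChart_eventually (mem_extChartAt_source p) (hU.mem_nhds hp)] with y hy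
    exact hEq _ hy.2
  have hdef : covDerivTensor (inducedMetric f c χ) (shapeOperator f c χ N) (unitT f c χ) p
      (unitT f c χ p)
    = covDeriv (inducedMetric f c χ) (fun x => shapeOperator f c χ N x (unitT f c χ x)) p
        (unitT f c χ p)
      - shapeOperator f c χ N p (covDeriv (inducedMetric f c χ) (unitT f c χ) p (unitT f c χ p)) :=
    rfl
  rw [hdef, hcov, h00, sub_zero]
  refine h.eq_of_inducedBilin fun w => ?_
  have hG := h.inducedBilin_covDeriv p _ (unitT f c χ p) w hu
  rw [hcov, map_zero, LinearMap.zero_apply] at hG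
  rw [h.inducedBilin_covDeriv p _ _ w hsm, covAlong_congr f c _ hch,
    covAlong_smul f c ((h.contDiffAt_eigenvalue hU hT hA hp).differentiableAt (by simp))
      ((contDiffAt_inChart (mem_extChartAt_source p) hu).differentiableAt (by simp)),
    map_add, LinearMap.add_apply, map_smul, map_smul, LinearMap.smul_apply, LinearMap.smul_apply,
    ← hG, smul_zero, add_zero, inChart_self, ← diffReal_eq
      (hlc.mdifferentiableAt (by simp)), map_smul, LinearMap.smul_apply]
  rfl

/-- The integral curves of `T / |T|` are geodesics. -/
theorem isGeodesicOn_of_isMIntegralCurveOn (h : IsWarpedHypersurface I f c χ N)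
    (hT : ∀ x ∈ U, fieldT f c χ x ≠ 0)
    (hA : ∀ x ∈ U, shapeOperator f c χ N x (fieldT f c χ x) = lam x • fieldT f c χ x)
    {γ : ℝ → M} {J : Set ℝ} (hJ : IsOpen J) (hγU : MapsTo γ J U)
    (hγ : IsMIntegralCurveOn (I := 𝓡 n) γ (unitT f c χ) J) :
    IsGeodesicOn (inducedMetric f c χ) γ J := by
  have hmain : ∀ s ∈ J, ContMDiffAt 𝓘(ℝ, ℝ) (𝓡 n) ∞ γ s ∧
      deriv (deriv fun r => extChartAt (𝓡 n) (γ s) (γ r)) s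
        + christoffel (inducedMetric f c χ) (γ s)
            (deriv (fun r => extChartAt (𝓡 n) (γ s) (γ r)) s)
            (deriv (fun r => extChartAt (𝓡 n) (γ s) (γ r)) s) = 0 := by
    intro s hs
    set p := γ s with hp
    set F := chartField (unitT f c χ) p with hF
    set g : ℝ → EuclideanSpace ℝ (Fin n) := fun r => extChartAt (𝓡 n) p (γ r) with hg
    -- On the parameters for which `γ` stays in the chart around `γ s`, the curve solves the
    -- autonomous equation `g' = F(g)`.
    set J' := J ∩ γ ⁻¹' (extChartAt (𝓡 n) p).source with hJ'
    have hJ'o : IsOpen J' := hγ.continuousOn.isOpen_inter_preimage hJ (isOpen_extChartAt_source p)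
    have hsJ : s ∈ J' := ⟨hs, mem_extChartAt_source p⟩
    have hgd : ∀ r ∈ J', HasDerivAt g (F (g r)) r := by
      intro r hr
      have : IsManifold (𝓡 n) 1 M := IsManifold.of_le (n := ∞) (by norm_num)
      have h1 := (hγ r hr.1).hasMFDerivAt (hJ.mem_nhds hr.1)
      have h2 : MDifferentiableAt (𝓡 n) 𝓘(ℝ, EuclideanSpace ℝ (Fin n)) (extChartAt (𝓡 n) p)
        (γ r) := mdifferentiableAt_extChartAt (by simpa using hr.2)
      let L : ℝ →L[ℝ] EuclideanSpace ℝ (Fin n) :=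
        (mfderiv (𝓡 n) 𝓘(ℝ, EuclideanSpace ℝ (Fin n)) (extChartAt (𝓡 n) p) (γ r)).comp
          ((1 : ℝ →L[ℝ] ℝ).smulRight (unitT f c χ (γ r)))
      have h3 : HasFDerivAt g L r := (h2.hasMFDerivAt.comp r h1).hasFDerivAt
      have h4 : F (g r) = (mfderiv (𝓡 n) 𝓘(ℝ, EuclideanSpace ℝ (Fin n)) (extChartAt (𝓡 n) p)
          (γ r) (unitT f c χ (γ r)) : EuclideanSpace ℝ (Fin n)) := by
        have key : ∀ q, q = γ r → (mfderiv (𝓡 n) (𝓡 n) (extChartAt (𝓡 n) p) q (unitT f c χ q) :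
            EuclideanSpace ℝ (Fin n)) = (mfderiv (𝓡 n) 𝓘(ℝ, EuclideanSpace ℝ (Fin n))
              (extChartAt (𝓡 n) p) (γ r) (unitT f c χ (γ r)) : EuclideanSpace ℝ (Fin n)) := by
          rintro q rfl
          rfl
        exact key _ ((extChartAt (𝓡 n) p).left_inv hr.2)
      refine h3.hasDerivAt.congr_deriv ?_
      rw [h4]
      refine congrArg (mfderiv (𝓡 n) 𝓘(ℝ, EuclideanSpace ℝ (Fin n)) (extChartAt (𝓡 n) p)
          (γ r)) ?_
      exact one_smul ℝ (unitT f c χ (γ r))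
    have hFd : ∀ r ∈ J', ContDiffAt ℝ ∞ F (g r) := fun r hr =>
      contDiffAt_chartField _ hr.2 h.smooth h.immersion
        (h.contMDiffAt_diffAmb_unitT (hT _ (hγU hr.1)))
    have hgs := (contDiffOn_of_hasDerivAt_comp hJ'o hgd hFd).contDiffAt (hJ'o.mem_nhds hsJ)
    refine ⟨?_, ?_⟩
    · have h1 : ContMDiffAt 𝓘(ℝ, EuclideanSpace ℝ (Fin n)) (𝓡 n) ∞ (extChartAt (𝓡 n) p).symm
          (g s) := (contMDiffOn_extChartAt_symm p).contMDiffAt (extChartAt_target_mem_nhds p)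
      refine (h1.comp s hgs.contMDiffAt).congr_of_eventuallyEq ?_
      filter_upwards [hJ'o.mem_nhds hsJ] with r hr
      exact ((extChartAt (𝓡 n) p).left_inv hr.2).symm
    -- Since `g'' = DF(F)`, the geodesic equation at `s` is `∇_E E = 0` in the chart.
    · have hd1 : deriv g =ᶠ[𝓝 s] fun r => F (g r) := by
        filter_upwards [hJ'o.mem_nhds hsJ] with r hr
        exact (hgd r hr).deriv
      have hd2 : HasDerivAt (fun r => F (g r)) _ s :=
        ((hFd s hsJ).differentiableAt (by simp)).hasFDerivAt.comp_hasDerivAt s (hgd s hsJ)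
      have hcov := h.covDeriv_unitT (hT p (hγU hs)) (hA p (hγU hs))
      rw [covDeriv_eq] at hcov
      have hcov := (tangentModel p).symm.map_eq_zero_iff.1 hcov
      have hFs : F (g s) = tangentModel p (unitT f c χ p) := chartField_self _ p
      rw [hd1.deriv_eq, hd1.eq_of_nhds, hd2.deriv, hFs]
      exact hcov
  exact ⟨fun s hs => (hmain s hs).1.contMDiffWithinAt, fun s hs => (hmain s hs).2⟩

/-- Near a point of `U` the angle function and the eigenvalue are functions of the height. -/
theorem exists_nhds_eq_of_height_eq (h : IsWarpedHypersurface I f c χ N) (hU : IsOpen U)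
    (hT : ∀ x ∈ U, fieldT f c χ x ≠ 0) {a : M → ℝ}
    (ha : ∀ x ∈ U, MDifferentiableAt (𝓡 n) 𝓘(ℝ, ℝ) a x ∧ ∃ k : ℝ, ∀ w : TangentSpace (𝓡 n) x,
      diffReal a x w = k * (diffAmb χ x w).1) {p : M} (hp : p ∈ U) :
    ∃ W ∈ 𝓝 p, ∀ x ∈ W, ∀ y ∈ W, heightFun χ x = heightFun χ y → a x = a y := by
  have hne : fderiv ℝ (inChart p (heightFun χ)) (extChartAt (𝓡 n) p p) ≠ 0 := by
    intro h0
    have := h.fderiv_height_fieldT (p := p)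
    rw [h0, _root_.zero_apply] at this
    exact (h.angle_pos (hT p hp)).ne this
  obtain ⟨V, hV, hVeq⟩ := exists_nhds_eq_of_fderiv_proportional (h := inChart p a)
    ((h.contDiffAt_height p).of_le (by norm_cast)) hne (by
      filter_upwards [inChart_eventually (mem_extChartAt_source p) (hU.mem_nhds hp)] with y hy
      have hsymm : MDifferentiableAt 𝓘(ℝ, EuclideanSpace ℝ (Fin n)) (𝓡 n)
          (extChartAt (𝓡 n) p).symm y := by
        have : IsManifold (𝓡 n) 1 M := IsManifold.of_le (n := ∞) (by norm_num)
        exact (mdifferentiableOn_extChartAt_symm y hy.1).mdifferentiableAt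
          (extChartAt_target_mem_nhds' hy.1)
      refine ⟨((ha _ hy.2).1.comp y hsymm).differentiableAt,
        ((h.mdifferentiable_height _).comp y hsymm).differentiableAt, ?_⟩
      obtain ⟨k, hk⟩ := (ha _ hy.2).2
      refine ⟨k, ?_⟩
      ext v
      rw [← diffReal_mfderiv_symm hy.1 (ha _ hy.2).1, hk, ← h.mfderiv_height,
        diffReal_mfderiv_symm hy.1 (h.mdifferentiable_height _)]
      rfl)
  refine ⟨(extChartAt (𝓡 n) p).source ∩ extChartAt (𝓡 n) p ⁻¹' V,
    Filter.inter_mem (extChartAt_source_mem_nhds p)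
      ((continuousAt_extChartAt p).preimage_mem_nhds hV), fun x hx y hy hxy => ?_⟩
  have := hVeq _ hx.2 _ hy.2
  simp only [inChart, (extChartAt (𝓡 n) p).left_inv hx.1, (extChartAt (𝓡 n) p).left_inv hy.1]
    at this
  exact this hxy

/-- On `S` the height is constantly `t`, so `a` is locally constant on `S`, and connectedness makes
it constant. -/
theorem eq_on_level (h : IsWarpedHypersurface I f c χ N) (hU : IsOpen U)
    (hT : ∀ x ∈ U, fieldT f c χ x ≠ 0) {a : M → ℝ}
    (ha : ∀ x ∈ U, MDifferentiableAt (𝓡 n) 𝓘(ℝ, ℝ) a x ∧ ∃ k : ℝ, ∀ w : TangentSpace (𝓡 n) x,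
      diffReal a x w = k * (diffAmb χ x w).1)
    {t : ℝ} {S : Set M} (hS : S ⊆ U ∩ heightFun χ ⁻¹' {t}) (hSc : IsPreconnected S) {x y : M}
    (hx : x ∈ S) (hy : y ∈ S) : a x = a y := by
  refine hSc.eq_of_locally_eq (fun z hz => ?_) hx hy
  obtain ⟨W, hW, hWa⟩ := h.exists_nhds_eq_of_height_eq hU hT ha (hS hz).1
  exact ⟨W, hW, fun b hb => hWa b hb.1 z (mem_of_mem_nhds hW)
    ((hS hb.2).2.trans (hS hz).2.symm)⟩

end IsWarpedHypersurface

end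

theorem mainTheorem8 {n : ℕ} {M : Type*} [TopologicalSpace M]
    [ChartedSpace (EuclideanSpace ℝ (Fin n)) M] [IsManifold (𝓡 n) ∞ M]
    (I : Set ℝ) (hIopen : IsOpen I) (hIconn : I.OrdConnected)
    (f : ℝ → ℝ) (hf : ContDiffOn ℝ ∞ f I) (hfpos : ∀ t ∈ I, 0 < f t)
    (c : ℝ) (hc : c = -1 ∨ c = 0 ∨ c = 1)
    (χ N : M → Amb n) (hM : IsHypersurface I f c χ N)
    (U : Set M) (hU : IsOpen U) (lam : M → ℝ)
    (hT : ∀ x ∈ U, fieldT f c χ x ≠ 0)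
    (hA : ∀ x ∈ U, shapeOperator f c χ N x (fieldT f c χ x) = lam x • fieldT f c χ x) :
    (∀ (γ : ℝ → M) (J : Set ℝ), IsOpen J → MapsTo γ J U →
      IsMIntegralCurveOn (I := 𝓡 n) γ (unitT f c χ) J →
        IsGeodesicOn (inducedMetric f c χ) γ J) ∧
    ContMDiffOn (𝓡 n) 𝓘(ℝ, ℝ) ∞ lam U ∧
    (∀ x ∈ U,
      riemGradient (inducedMetric f c χ) lam x
        = covDerivTensor (inducedMetric f c χ) (shapeOperator f c χ N) (unitT f c χ) x
            (unitT f c χ x) ∧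
      riemGradient (inducedMetric f c χ) lam x
        = inducedMetric f c χ x (unitT f c χ x) (riemGradient (inducedMetric f c χ) lam x)
            • unitT f c χ x) ∧
    (∀ x ∈ U,
      riemGradient (inducedMetric f c χ) (angleFun f c χ N) x
        = -((lam x + deriv f (heightFun χ x) / f (heightFun χ x) * angleFun f c χ N x)
            • fieldT f c χ x)) ∧
    (∀ (t : ℝ) (S : Set M), S ⊆ U ∩ heightFun χ ⁻¹' {t} → IsPreconnected S →
      ∀ x ∈ S, ∀ y ∈ S,
        normSqT f c χ x = normSqT f c χ y ∧
        angleFun f c χ N x = angleFun f c χ N y ∧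
        lam x = lam y) := by
  have h : IsWarpedHypersurface I f c χ N := ⟨hM, hIopen, hf, hfpos, hc⟩
  have hgrad : ∀ x ∈ U, riemGradient (inducedMetric f c χ) lam x
      = diffReal lam x (unitT f c χ x) • unitT f c χ x := fun x hx =>
    h.riemGradient_eq _ fun w => by
      rw [h.mfderiv_eigenvalue hU hT hA hx w, map_smul, LinearMap.smul_apply, smul_eq_mul]
  refine ⟨fun γ J hJ hγU hγ => h.isGeodesicOn_of_isMIntegralCurveOn hT hA hJ hγU hγ,
    h.contMDiffOn_eigenvalue hU hT hA, fun x hx => ⟨?_, ?_⟩,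
    fun x hx => h.riemGradient_angle (hA x hx), fun t S hS hSc x hx y hy => ?_⟩
  · rw [hgrad x hx, h.covDerivTensor_unitT hU hT hA hx]
  · rw [hgrad x hx, inducedMetric_eq, map_smul, h.inducedBilin_unitT_self (hT x hx), smul_eq_mul,
      mul_one]
  · have hangle : angleFun f c χ N x = angleFun f c χ N y :=
      h.eq_on_level hU hT (fun z hz => ⟨h.contMDiff_angle.mdifferentiable (by simp) z, _,
        fun w => by rw [h.mfderiv_angle_of_eigen (hA z hz), ← neg_mul]⟩) hS hSc hx hy
    refine ⟨by rw [h.normSqT_eq, h.normSqT_eq, hangle], hangle, ?_⟩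
    -- The factor comes from `dλ(w) = dλ(E) ⟨E, w⟩` and `⟨E, w⟩ = |T|⁻¹ dπ(w)`, where `E = T/|T|`.
    refine h.eq_on_level hU hT (fun z hz => ⟨?_, diffReal lam z (unitT f c χ z)
      * (Real.sqrt (1 - angleFun f c χ N z ^ 2))⁻¹, fun w => ?_⟩) hS hSc hx hy
    · exact ((h.contMDiffOn_eigenvalue hU hT hA).contMDiffAt (hU.mem_nhds hz)).mdifferentiableAt
        (by simp)
    · rw [h.mfderiv_eigenvalue hU hT hA hz w]
      conv_lhs => rw [h.unitT_eq z, map_smul (inducedBilin f c χ z), LinearMap.smul_apply,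
        h.inducedBilin_fieldT, smul_eq_mul, ← h.unitT_eq z]
      ring
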